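/- Let $n\ge 1$, let $\mathfrak g=\mathfrak{so}(2n+1)$ be the Lie algebra of the compact group $\mathrm{Spin}(2n+1)$, with complexification $\mathfrak g^{\mathbb C}$, and let $\mathfrak t\subset\mathfrak g$ be the Lie algebra of the standard maximal torus, with basis $E_1,\dots,E_n$, where $E_i$ is the infinitesimal rotation of the $i$-th of $n$ orthogonal coordinate planes of $\mathbb R^{2n+1}$. Let $L_1,\dots,L_n$ be the functionals on $\mathfrak t$ with $L_i(E_j)=\sqrt{-1}\,\delta_{ij}$. Take the positive roots $\Delta^+=\{L_i\pm L_j\}_{i<j}\cup\{L_i\}_i$, with simple roots $\alpha_i=L_i-L_{i+1}$ ($i<n$) and $\alpha_n=L_n$; let $H_i=E_1+\dots+E_i$ ($1\le i\le n$), so that $\alpha_i(H_j)=\sqrt{-1}\,\delta_{ij}$, and let $\omega_k=L_1+\dots+L_k$ ($k<n$), $\omega_n=\frac12(L_1+\dots+L_n)$ be the fundamental weights. Let $\mathfrak I=\{\xi\in\mathfrak t:\exp(2\pi\xi)=e\text{ in }\mathrm{Spin}(2n+1)\}$ and $\mathfrak I'=\{\xi\in\mathfrak I:\alpha(\xi)/\sqrt{-1}\ge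 0\text{ for all }\alpha\in\Delta^+\}$. For $\xi\in\mathfrak I'$ and $i\in\mathbb Z$ let $\mathfrak p_i^\xi=\bigoplus_{j\le i}\mathfrak g_j^\xi$, where $\mathfrak g_j^\xi\subseteq\mathfrak g^{\mathbb C}$ is the $\sqrt{-1}\,j$-eigenspace of $\operatorname{ad}\xi$. Write $\xi\preceq\xi'$ if $\mathfrak p_i^\xi\subseteq\mathfrak p_i^{\xi'}$ for all $i\ge0$. For $I\subseteq\{1,\dots,n\}$ let $\mathfrak C_I=\{\sum_{i=1}^n c_iH_i: c_i\ge0,\ c_i=0\text{ iff }i\notin I\}$. An *$I$-canonical element* of $\mathrm{Spin}(2n+1)$ is a maximal element of $(\mathfrak I'\cap\mathfrak C_I,\preceq)$. For a finite-dimensional complex irreducible representation $\rho$ with highest weight $\omega^*$ and lowest weight $\varpi^*$, and $\xi\in\mathfrak t$, put $r_\rho(\xi)=(\omega^*(\xi)-\varpi^*(\xi))/\sqrt{-1}$. Let $\rho_k$ be the irreducible representation with highest weight $\omega_k$. **Theorem.** Fix $I\subseteq\{1,\dots,n\}$ and set $\xi_I=\sum_{i\in I}H_i$. 1. If $\sum_{i\in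 I}i$ is even, then $\xi_I$ is the unique $I$-canonical element of $\mathrm{Spin}(2n+1)$. 2. If $\sum_{i\in I}i$ is odd, then the $I$-canonical elements of $\mathrm{Spin}(2n+1)$ are precisely the elements $\xi_I^j=H_j+\xi_I$ with $j\in I$ odd. 3. In both cases, for $1\le k<n$, $$r_{\rho_k}(\xi_I)=\sum_{m=1}^{k}2\,|I\cap\{m,\dots,n\}|,$$ and, if $\sum_{i\in I}i$ is odd and $j\in I$ is odd, $$r_{\rho_k}(\xi_I^j)=r_{\rho_k}(\xi_I)+2\min\{j,k\}.$$ 4. For $k=n$ these values are divided by $2$: $$r_{\rho_n}(\xi_I)=\tfrac12\sum_{m=1}^{n}2\,|I\cap\{m,\dots,n\}|,$$ and, if $\sum_{i\in I}i$ is odd and $j\in I$ is odd, $$r_{\rho_n}(\xi_I^j)=\tfrac12\Big(\sum_{m=1}^{n}2\,|I\cap\{m,\dots,n\}|+2\min\{j,n\}\Big).$$ -/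

import Mathlib

namespace SpinCanonical

open Complex

noncomputable section

/-! ### The group `Spin(2n+1)`, its Lie algebra and the maximal torus -/

/-- The `2n+1` coordinates of `ℝ^{2n+1}`: one coordinate `z`, then `x_1, …, x_n`, then
`y_1, …, y_n`. -/
abbrev Idx (n : ℕ) : Type := Unit ⊕ Fin n ⊕ Fin n

/-- The position of `x_i`. -/
abbrev xIdx {n : ℕ} (i : Fin n) : Idx n := Sum.inr (Sum.inl i)

/-- The position of `y_i`. -/
abbrev yIdx {n : ℕ} (i : Fin n) : Idx n := Sum.inr (Sum.inr i)

/-- The standard positive definite quadratic form `v ↦ ∑ v_a ^ 2` on `ℝ^{2n+1}`; in its Clifford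
algebra `v * v = ∑ v_a ^ 2`. -/
abbrev stdForm (n : ℕ) : QuadraticForm ℝ (Idx n → ℝ) :=
  QuadraticMap.weightedSumSquares ℝ (fun _ : Idx n => (1 : ℝ))

/-- The compact group `Spin(2n+1)`. -/
abbrev Spin (n : ℕ) : Type := spinGroup (stdForm n)

/-- The compact Lie algebra `𝔤 = 𝔰𝔬(2n+1)` of real skew-symmetric matrices. -/
abbrev LieG (n : ℕ) : Type := LieAlgebra.Orthogonal.so (Idx n) ℝ

/-- Its complexification `𝔤^ℂ = 𝔰𝔬(2n+1, ℂ)`. -/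
abbrev LieGC (n : ℕ) : Type := LieAlgebra.Orthogonal.so (Idx n) ℂ

/-- The inclusion of `𝔤` in `𝔤^ℂ`. -/
def toComplex {n : ℕ} (X : LieG n) : LieGC n :=
  ⟨(X : Matrix (Idx n) (Idx n) ℝ).map (fun r : ℝ => (r : ℂ)), by
    have h := (LieAlgebra.Orthogonal.mem_so (Idx n) ℝ _).1 X.2
    rw [LieAlgebra.Orthogonal.mem_so]
    ext a b
    have h2 := congrFun (congrFun h a) b
    simp only [Matrix.transpose_apply, Matrix.neg_apply, Matrix.map_apply] at h2 ⊢
    rw [h2]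
    simp⟩

/-- The identification of `𝔰𝔬(2n+1)` with the Lie algebra of `Spin(2n+1)` inside the Clifford
algebra: `X ↦ (1/4) ∑_{a,b} X_{ab} e_a e_b`, so that `[toClifford X, v] = X v` for every vector `v`
(equivalently, `a ∧ b ↦ [a,b]/2`, where `a ∧ b` is the map `v ↦ 2 (⟨b,v⟩ a - ⟨a,v⟩ b)`). -/
def toClifford {n : ℕ} (X : LieG n) : CliffordAlgebra (stdForm n) :=
  (1 / 4 : ℝ) • ∑ a : Idx n, ∑ b : Idx n,
    ((X : Matrix (Idx n) (Idx n) ℝ) a b) •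
      (CliffordAlgebra.ι (stdForm n) (Pi.single a 1) *
        CliffordAlgebra.ι (stdForm n) (Pi.single b 1))

/-- `IsExp X g` says that `g = exp X` in the Lie group `Spin(2n+1)`: `g = γ 1` for the one-parameter
subgroup `γ` of `Spin(2n+1)` with `γ'(0) = X`. The derivative is taken in the finite-dimensional
vector space underlying the Clifford algebra, hence can be tested against linear functionals. -/
def IsExp {n : ℕ} (X : LieG n) (g : Spin n) : Prop :=
  ∃ γ : ℝ → Spin n,
    (∀ s t : ℝ, γ (s + t) = γ s * γ t) ∧
    (∀ f : CliffordAlgebra (stdForm n) →ₗ[ℝ] ℝ,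
      HasDerivAt (fun t : ℝ => f (γ t : CliffordAlgebra (stdForm n))) (f (toClifford X)) 0) ∧
    γ 1 = g

/-- The infinitesimal rotation `x_i ↦ y_i`, `y_i ↦ -x_i`. Its eigenvalues on `ℂ^{2n+1}` are `√-1`,
`-√-1` (on `x_i ∓ √-1 y_i`) and `0`. -/
def rot {n : ℕ} (i : Fin n) : LieG n :=
  ⟨Matrix.single (yIdx i) (xIdx i) 1 - Matrix.single (xIdx i) (yIdx i) 1, by
    rw [LieAlgebra.Orthogonal.mem_so]
    simp [Matrix.transpose_sub]⟩

/-- The Lie algebra `𝔱 = {∑ a_i E_i : a_i ∈ ℝ}` of the maximal torus. -/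
def torus (n : ℕ) : Submodule ℝ (LieG n) := Submodule.span ℝ (Set.range (rot (n := n)))

/-- The basis `E_i` of `𝔱` (the index `i : Fin n` stands for the number `i + 1`). -/
def E {n : ℕ} (i : Fin n) : torus n := ⟨rot i, Submodule.subset_span ⟨i, rfl⟩⟩

/-- The functional `L_i` on `𝔱`, with `L_i (E_j) = √-1 δ_{ij}`: the entry at `(y_i, x_i)`, times
`√-1`. -/
def L {n : ℕ} (i : Fin n) : torus n →ₗ[ℝ] ℂ where
  toFun X := (((X : LieG n) : Matrix (Idx n) (Idx n) ℝ) (yIdx i) (xIdx i) : ℂ) * I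
  map_add' X Y := by simp [add_mul]
  map_smul' c X := by simp [mul_assoc]

theorem L_E {n : ℕ} (i j : Fin n) : L i (E j) = if i = j then I else 0 := by
  by_cases h : i = j
  · subst h
    simp [L, E, rot, Matrix.single]
  · simp [L, E, rot, Matrix.single, h, Ne.symm h]

/-! ### Roots and weights -/

/-- The positive roots `L_i ± L_j` (`i < j`) and `L_i`. -/
def posRoots (n : ℕ) : Set (torus n →ₗ[ℝ] ℂ) :=
  {α | (∃ i j : Fin n, i < j ∧ (α = L i - L j ∨ α = L i + L j)) ∨ ∃ i : Fin n, α = L i}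

/-- The simple roots `α_i = L_i - L_{i+1}` for `i < n`, and `α_n = L_n` (again `i : Fin n` stands
for `i + 1`). -/
def simpleRoot {n : ℕ} (i : Fin n) : torus n →ₗ[ℝ] ℂ :=
  if h : (i : ℕ) + 1 < n then L i - L ⟨(i : ℕ) + 1, h⟩ else L i

/-- `H_i = E_1 + ⋯ + E_i`, for `i ∈ {1, …, n}`: the basis of `𝔱` dual to the simple roots. -/
def H (n i : ℕ) : torus n := ∑ j ∈ Finset.univ.filter (fun j : Fin n => (j : ℕ) + 1 ≤ i), E j

theorem L_H {n : ℕ} (i : Fin n) (m : ℕ) : L i (H n m) = if (i : ℕ) + 1 ≤ m then I else 0 := by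
  simp [H, L_E]

theorem simpleRoot_H {n : ℕ} (i j : Fin n) :
    simpleRoot i (H n ((j : ℕ) + 1)) = if i = j then I else 0 := by
  unfold simpleRoot
  have hi := i.2
  have hj := j.2
  split_ifs with h1 h2 h2
  · subst h2
    simp [L_H]
  · rw [LinearMap.sub_apply, L_H, L_H]
    have h3 : (i : ℕ) ≠ j := fun h => h2 (Fin.ext h)
    split_ifs with h4 h5 h5
    · simp
    · simp only at h5; omega
    · simp only at h5; omega
    · simp
  · subst h2
    simp [L_H]
  · have h3 : (i : ℕ) ≠ j := fun h => h2 (Fin.ext h)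
    rw [L_H, if_neg (by omega)]

/-- The fundamental weights `ω_k = L_1 + ⋯ + L_k` for `1 ≤ k < n`, and
`ω_n = (L_1 + ⋯ + L_n) / 2`. -/
def fundWeight (n k : ℕ) : torus n →ₗ[ℝ] ℂ :=
  if k < n then ∑ j ∈ Finset.univ.filter (fun j : Fin n => (j : ℕ) + 1 ≤ k), L j
  else (1 / 2 : ℝ) • ∑ j : Fin n, L j

/-- The root space `𝔤_α ⊆ 𝔤^ℂ`. -/
def rootSpace {n : ℕ} (α : torus n →ₗ[ℝ] ℂ) : Set (LieGC n) :=
  {x | ∀ X : torus n, ⁅toComplex (X : LieG n), x⁆ = α X • x}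

section Representations

variable (n : ℕ) (V : Type*) [AddCommGroup V] [Module ℂ V] [LieRingModule (LieGC n) V]

/-- `ω` is the weight of a nonzero vector annihilated by all `𝔤_α` with `α` positive. -/
def IsHighestWeight (ω : torus n →ₗ[ℝ] ℂ) : Prop :=
  ∃ v : V, v ≠ 0 ∧ (∀ X : torus n, ⁅toComplex (X : LieG n), v⁆ = ω X • v) ∧
    ∀ α ∈ posRoots n, ∀ x ∈ rootSpace α, ⁅x, v⁆ = 0

/-- `ω` is the weight of a nonzero vector annihilated by all `𝔤_{-α}` with `α` positive. -/
def IsLowestWeight (ω : torus n →ₗ[ℝ] ℂ) : Prop :=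
  ∃ v : V, v ≠ 0 ∧ (∀ X : torus n, ⁅toComplex (X : LieG n), v⁆ = ω X • v) ∧
    ∀ α ∈ posRoots n, ∀ x ∈ rootSpace (-α), ⁅x, v⁆ = 0

/-- The highest weight of `V` (it exists and is unique if `V` is irreducible of finite
dimension). -/
def highestWeight : torus n →ₗ[ℝ] ℂ := Classical.epsilon (IsHighestWeight n V)

/-- The lowest weight of `V` (it exists and is unique if `V` is irreducible of finite
dimension). -/
def lowestWeight : torus n →ₗ[ℝ] ℂ := Classical.epsilon (IsLowestWeight n V)

/-- The uniton number `r_ρ(ξ)`: highest weight minus lowest weight, at `ξ`. As weights take values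
in `√-1 ℝ` on `𝔱`, the value is divided by `√-1`. -/
def unitonNumber (ξ : torus n) : ℂ := (highestWeight n V ξ - lowestWeight n V ξ) / I

end Representations

/-! ### Canonical elements -/

/-- The integer lattice `𝔍(G) = (2π)⁻¹ exp⁻¹(e) ∩ 𝔱` of `G = Spin(2n+1)`. -/
def integerLattice (n : ℕ) : Set (torus n) :=
  {ξ | IsExp ((2 * Real.pi) • (ξ : LieG n)) (1 : Spin n)}

/-- The elements `ξ` of `𝔍(G)` with `α(ξ) ≥ 0` for all positive roots `α`, where `α(ξ) ∈ √-1 ℝ` is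
identified with the real number `α(ξ) / √-1`. -/
def dominantLattice (n : ℕ) : Set (torus n) :=
  {ξ | ξ ∈ integerLattice n ∧ ∀ α ∈ posRoots n, 0 ≤ (α ξ).im}

/-- `𝔤_j^ξ`: the `√-1 j`-eigenspace of `ad ξ` on `𝔤^ℂ`. -/
def gradedPart {n : ℕ} (ξ : torus n) (j : ℤ) : Submodule ℂ (LieGC n) :=
  Module.End.eigenspace
    (LieAlgebra.ad ℂ (LieGC n) (toComplex (ξ : LieG n)) : Module.End ℂ (LieGC n)) ((j : ℂ) * I)

/-- `𝔭_i^ξ`: the sum of the `𝔤_j^ξ` with `j ≤ i`. -/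
def filteredPart {n : ℕ} (ξ : torus n) (i : ℤ) : Submodule ℂ (LieGC n) :=
  ⨆ (j : ℤ) (_ : j ≤ i), gradedPart ξ j

/-- The relation `ξ ≼ ξ'`: `𝔭_i^ξ ⊆ 𝔭_i^ξ'` for all `i ≥ 0`. -/
def Preceq {n : ℕ} (ξ ξ' : torus n) : Prop :=
  ∀ i : ℤ, 0 ≤ i → filteredPart ξ i ≤ filteredPart ξ' i

/-- The cone `ℭ_I` of all `∑ c_i H_i` with `c_i ≥ 0`, and `c_i = 0` if and only if `i ∉ I`. -/
def cone (n : ℕ) (S : Finset ℕ) : Set (torus n) :=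
  {ξ | ∃ c : ℕ → ℝ, (∀ i ∈ Finset.Icc 1 n, 0 ≤ c i ∧ (c i = 0 ↔ i ∉ S)) ∧
    ξ = ∑ i ∈ Finset.Icc 1 n, c i • H n i}

/-- `ξ` is an `I`-canonical element of `Spin(2n+1)`: a maximal element of the dominant part of the
integer lattice intersected with `ℭ_I`, for `≼`. -/
def IsCanonical (n : ℕ) (S : Finset ℕ) (ξ : torus n) : Prop :=
  ξ ∈ dominantLattice n ∩ cone n S ∧
    ∀ ξ' ∈ dominantLattice n ∩ cone n S, Preceq ξ ξ' → ξ = ξ'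

/-- `ξ_I = ∑_{i ∈ I} H_i`. -/
def xi (n : ℕ) (S : Finset ℕ) : torus n := ∑ i ∈ S, H n i

end

end SpinCanonical

namespace SpinCanonical

open Complex

noncomputable section

variable {n : ℕ}

/-! ### Coordinates on the torus -/

/-! The problem becomes arithmetic in coordinates. A torus element has real coordinates `m i`, the
values of `L i` divided by `√-1`. In the Clifford algebra `exp(2πξ)` is the product of the commuting
rotors `cos(π m_i) + sin(π m_i) e_{y_i} e_{x_i}`. This equals 1 exactly when all `m i` are integers
with even sum (`mem_integerLattice_iff`). In terms of the coefficients `c k` of `H_k` the coordinate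
sum is `∑ k c_k`. So the dominant lattice elements in the cone of `S` are the functions `c` with
natural values and support `S` for which `∑ k c_k` is even (`mem_dominantLattice_inter_cone_iff`).

The relation `≼` is the reversed coefficientwise order (`preceq_combH_iff`): simple root vectors
detect the individual coefficients, and every positive root is nonnegative on each `H_k`. Canonical
elements are thus the minimal admissible `c`. The indicator of `S` lies below every admissible `c`.
If its parity is right it is the least one; otherwise an admissible `c` must exceed 1 at some odd `j
∈ S`, and adding 1 there already repairs the parity.

For the uniton numbers, `-1` belongs to the Weyl group of type B. Concretely, a diagonal sign
matrix, a product of rotations by `π`, acts as `-1` on the torus. It is implemented on every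
finite-dimensional module by exponentials, so it exchanges highest and lowest weight vectors
(`isLowestWeight_neg_iff`). As the highest weight of an irreducible module is unique
(`IsHighestWeight.unique`), `r_ρ(ξ) = 2 ω(ξ) / √-1`, and only the values of fundamental weights on
`H_j` and `ξ_I` remain. -/

theorem E_sum_coe (m : Fin n → ℝ) (j : Fin n) : L j (∑ i, m i • E i) = (m j : ℂ) * I := by
  simp [L_E]

theorem torus_exists_coords (ξ : torus n) : ∃ m : Fin n → ℝ, ξ = ∑ i, m i • E i := by
  obtain ⟨m, hm⟩ := (Submodule.mem_span_range_iff_exists_fun ℝ).1 ξ.2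
  exact ⟨m, Subtype.ext (by simp [← hm, E])⟩

/-- The real coordinate `L_i / √-1`. -/
def coord (ξ : torus n) (i : Fin n) : ℝ := (L i ξ).im

theorem L_eq_coord (ξ : torus n) (i : Fin n) : L i ξ = (coord ξ i : ℂ) * I := by
  obtain ⟨m, rfl⟩ := torus_exists_coords ξ
  rw [coord, E_sum_coe]; simp

theorem coord_sum (m : Fin n → ℝ) (j : Fin n) : coord (∑ i, m i • E i) j = m j := by
  rw [coord, E_sum_coe]; simp

theorem eq_sum_coord (ξ : torus n) : ξ = ∑ i, coord ξ i • E i := by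
  obtain ⟨m, rfl⟩ := torus_exists_coords ξ
  exact Finset.sum_congr rfl fun i _ => by rw [coord_sum]

theorem coe_lie (A B : LieGC n) : ((⁅A, B⁆ : LieGC n) : Matrix (Idx n) (Idx n) ℂ) =
    (A : Matrix (Idx n) (Idx n) ℂ) * B - (B : Matrix (Idx n) (Idx n) ℂ) * A := rfl

theorem coe_add (A B : LieGC n) : ((A + B : LieGC n) : Matrix (Idx n) (Idx n) ℂ) =
    (A : Matrix (Idx n) (Idx n) ℂ) + B := rfl

theorem coe_smul (c : ℂ) (A : LieGC n) : ((c • A : LieGC n) : Matrix (Idx n) (Idx n) ℂ) =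
    c • (A : Matrix (Idx n) (Idx n) ℂ) := rfl

/-- The inclusion of the complex orthogonal Lie algebra in the space of matrices. -/
def coeₗ (n : ℕ) : LieGC n →ₗ[ℂ] Matrix (Idx n) (Idx n) ℂ where
  toFun A := A
  map_add' := coe_add
  map_smul' := coe_smul

theorem coe_sum {κ : Type*} (s : Finset κ) (f : κ → LieGC n) :
    ((∑ k ∈ s, f k : LieGC n) : Matrix (Idx n) (Idx n) ℂ) =
      ∑ k ∈ s, (f k : Matrix (Idx n) (Idx n) ℂ) := map_sum (coeₗ n) f s

/-- The complexification map as a real linear map. -/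
def toComplexₗ (n : ℕ) : LieG n →ₗ[ℝ] LieGC n where
  toFun := toComplex
  map_add' X Y := by ext a b; simp [toComplex]
  map_smul' c X := by ext a b; simp [toComplex]

theorem toComplex_torus (ξ : torus n) :
    (toComplex (ξ : LieG n) : LieGC n) = ∑ i, (coord ξ i) • toComplex (rot i) := by
  have h : ((ξ : torus n) : LieG n) = ∑ i, coord ξ i • rot i := by
    conv_lhs => rw [eq_sum_coord ξ]
    simp [E]
  rw [h]
  exact (map_sum (toComplexₗ n) _ _).trans
    (Finset.sum_congr rfl fun i _ => (toComplexₗ n).map_smul _ _)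

theorem coe_toComplex_rot (i : Fin n) :
    (toComplex (rot i) : Matrix (Idx n) (Idx n) ℂ) =
      Matrix.single (yIdx i) (xIdx i) 1 - Matrix.single (xIdx i) (yIdx i) 1 := by
  ext a b
  change (((Matrix.single (yIdx i) (xIdx i) (1 : ℝ) - Matrix.single (xIdx i) (yIdx i) 1 :
    Matrix (Idx n) (Idx n) ℝ) a b : ℝ) : ℂ) = _
  simp only [Matrix.sub_apply, Matrix.single_apply]
  split_ifs <;> simp

/-! ### The root space decomposition -/

/-- The weight vectors of the standard representation. -/
def stdVec : Idx n → Idx n → ℂ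
  | Sum.inl _ => Pi.single (Sum.inl ()) 1
  | Sum.inr (Sum.inl i) => Pi.single (xIdx i) 1 - I • Pi.single (yIdx i) 1
  | Sum.inr (Sum.inr i) => Pi.single (xIdx i) 1 + I • Pi.single (yIdx i) 1

/-- The weights of the standard representation. -/
def stdWeight : Idx n → (torus n →ₗ[ℝ] ℂ)
  | Sum.inl _ => 0
  | Sum.inr (Sum.inl i) => L i
  | Sum.inr (Sum.inr i) => -L i

theorem rot_mulVec_stdVec (i : Fin n) (a : Idx n) :
    (toComplex (rot i) : Matrix (Idx n) (Idx n) ℂ).mulVec (stdVec a) =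
      stdWeight a (E i) • stdVec a := by
  rw [coe_toComplex_rot, Matrix.sub_mulVec]
  rcases a with a | j | j
  · ext b
    simp [stdVec, stdWeight]
  · by_cases h : i = j
    · subst h
      simp only [stdVec, stdWeight, L_E]
      ext b
      simp [Matrix.single_mulVec, Function.update_apply, Pi.single_apply]
      split_ifs <;> simp_all
    · simp [stdVec, stdWeight, L_E, Matrix.single_mulVec, h, Ne.symm h]
  · by_cases h : i = j
    · subst h
      simp only [stdVec, stdWeight, LinearMap.neg_apply, L_E]
      ext b
      simp [Matrix.single_mulVec, Function.update_apply, Pi.single_apply]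
      split_ifs <;> simp_all
    · simp [stdVec, stdWeight, L_E, Matrix.single_mulVec, h, Ne.symm h]

theorem torus_mulVec_stdVec (ξ : torus n) (a : Idx n) :
    (toComplex (ξ : LieG n) : Matrix (Idx n) (Idx n) ℂ).mulVec (stdVec a) =
      stdWeight a ξ • stdVec a := by
  conv_rhs => rw [eq_sum_coord ξ]
  rw [toComplex_torus]
  simp only [coe_sum, map_sum, Finset.sum_smul, Matrix.sum_mulVec]
  refine Finset.sum_congr rfl fun i _ => ?_
  have : ((coord ξ i • toComplex (rot i) : LieGC n) : Matrix (Idx n) (Idx n) ℂ) =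
    coord ξ i • (toComplex (rot i) : Matrix (Idx n) (Idx n) ℂ) := rfl
  rw [this, Matrix.smul_mulVec, rot_mulVec_stdVec, map_smul, smul_assoc]

/-- The element `u vᵀ - v uᵀ` of the complex orthogonal Lie algebra. -/
def wedge (u v : Idx n → ℂ) : LieGC n :=
  ⟨Matrix.vecMulVec u v - Matrix.vecMulVec v u, by
    rw [LieAlgebra.Orthogonal.mem_so]
    simp [Matrix.transpose_sub, Matrix.transpose_vecMulVec]⟩

theorem coe_wedge (u v : Idx n → ℂ) : (wedge u v : Matrix (Idx n) (Idx n) ℂ) =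
    Matrix.vecMulVec u v - Matrix.vecMulVec v u := rfl

/-- Skewness turns the right action of `A` on row vectors into minus its action on columns, so `ad
A` is a derivation of the wedge. This identifies the adjoint representation with the exterior square
of the standard one, whose weights are sums of two standard weights. -/
theorem lie_wedge (A : LieGC n) (u v : Idx n → ℂ) :
    ⁅A, wedge u v⁆ = wedge ((A : Matrix (Idx n) (Idx n) ℂ).mulVec u) v +
      wedge u ((A : Matrix (Idx n) (Idx n) ℂ).mulVec v) := by
  have hA : (A : Matrix (Idx n) (Idx n) ℂ).transpose = -A :=
    (LieAlgebra.Orthogonal.mem_so (Idx n) ℂ _).1 A.2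
  have h : ∀ w : Idx n → ℂ, Matrix.vecMul w (A : Matrix (Idx n) (Idx n) ℂ) =
      -(A : Matrix (Idx n) (Idx n) ℂ).mulVec w := fun w => by
    rw [← Matrix.mulVec_transpose, hA, Matrix.neg_mulVec]
  apply Subtype.ext
  rw [coe_lie, coe_add, coe_wedge, coe_wedge,
    coe_wedge, mul_sub, sub_mul, Matrix.mul_vecMulVec, Matrix.mul_vecMulVec,
    Matrix.vecMulVec_mul, Matrix.vecMulVec_mul, h, h, Matrix.vecMulVec_neg, Matrix.vecMulVec_neg]
  abel

theorem wedge_self (u : Idx n → ℂ) : wedge u u = 0 := Subtype.ext (by rw [coe_wedge]; simp)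

/-- `wedge` as a bilinear map. -/
def wedgeₗ (n : ℕ) : (Idx n → ℂ) →ₗ[ℂ] (Idx n → ℂ) →ₗ[ℂ] LieGC n :=
  LinearMap.mk₂ ℂ wedge
    (fun u u' v => Subtype.ext (by
      simp only [coe_wedge, coe_add, Matrix.add_vecMulVec, Matrix.vecMulVec_add]
      abel))
    (fun c u v => Subtype.ext (by
      simp only [coe_wedge, coe_smul, Matrix.smul_vecMulVec, Matrix.vecMulVec_smul,
        smul_sub]))
    (fun u v v' => Subtype.ext (by
      simp only [coe_wedge, coe_add, Matrix.add_vecMulVec, Matrix.vecMulVec_add]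
      abel))
    (fun c u v => Subtype.ext (by
      simp only [coe_wedge, coe_smul, Matrix.smul_vecMulVec, Matrix.vecMulVec_smul,
        smul_sub]))

theorem wedgeₗ_apply (u v : Idx n → ℂ) : wedgeₗ n u v = wedge u v := rfl

theorem smul_wedge (c : ℂ) (u v : Idx n → ℂ) : wedge (c • u) v = c • wedge u v :=
  (wedgeₗ n).map_smul₂ c u v

theorem wedge_smul (c : ℂ) (u v : Idx n → ℂ) : wedge u (c • v) = c • wedge u v :=
  (wedgeₗ n u).map_smul c v

/-- The standard generators of the complex orthogonal Lie algebra. -/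
def rootVec (a b : Idx n) : LieGC n := wedge (stdVec a) (stdVec b)

theorem torus_lie_rootVec (ξ : torus n) (a b : Idx n) :
    ⁅toComplex (ξ : LieG n), rootVec a b⁆ = (stdWeight a + stdWeight b) ξ • rootVec a b := by
  rw [rootVec, lie_wedge, torus_mulVec_stdVec, torus_mulVec_stdVec, smul_wedge, wedge_smul,
    ← add_smul, LinearMap.add_apply]

theorem span_stdVec : Submodule.span ℂ (Set.range (stdVec (n := n))) = ⊤ := by
  rw [eq_top_iff, ← (Pi.basisFun ℂ (Idx n)).span_eq, Submodule.span_le]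
  rintro _ ⟨a, rfl⟩
  rw [Pi.basisFun_apply]
  have hm := fun b : Idx n =>
    Submodule.subset_span (R := ℂ) (Set.mem_range_self (f := stdVec (n := n)) b)
  rcases a with a | i | i
  · exact hm (Sum.inl ())
  · have : (Pi.single (xIdx i) 1 : Idx n → ℂ) =
        (1 / 2 : ℂ) • (stdVec (xIdx i) + stdVec (yIdx i)) := by
      simp only [stdVec]; module
    change (Pi.single (xIdx i) 1 : Idx n → ℂ) ∈ _
    rw [this]
    exact Submodule.smul_mem _ _ (Submodule.add_mem _ (hm _) (hm _))
  · have : (Pi.single (yIdx i) 1 : Idx n → ℂ) =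
        (I / 2 : ℂ) • (stdVec (xIdx i) - stdVec (yIdx i)) := by
      simp only [stdVec]
      have : ∀ u v : Idx n → ℂ, (I / 2) • (u - I • v - (u + I • v)) = (-(I * I)) • v := by
        intro u v; module
      rw [this]; simp
    change (Pi.single (yIdx i) 1 : Idx n → ℂ) ∈ _
    rw [this]
    exact Submodule.smul_mem _ _ (Submodule.sub_mem _ (hm _) (hm _))

/-- A skew matrix is half the sum of its entries times wedges of unit vectors, and by bilinearity
wedges of arbitrary vectors reduce to wedges of the weight basis. -/
theorem span_rootVec :
    Submodule.span ℂ (Set.range fun q : Idx n × Idx n => rootVec q.1 q.2) = ⊤ := by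
  rw [eq_top_iff]
  have key : ∀ u v : Idx n → ℂ,
      wedge u v ∈ Submodule.span ℂ (Set.range fun q : Idx n × Idx n => rootVec q.1 q.2) := by
    intro u v
    have h := Submodule.apply_mem_map₂ (wedgeₗ n) (Submodule.mem_top (x := u))
      (Submodule.mem_top (x := v))
    rw [← span_stdVec, Submodule.map₂_span_span] at h
    refine Submodule.span_mono ?_ h
    rintro _ ⟨_, ⟨a, rfl⟩, _, ⟨b, rfl⟩, rfl⟩
    exact ⟨(a, b), rfl⟩
  intro x _
  have hx : x = (1 / 2 : ℂ) • ∑ a, ∑ b, (x : Matrix (Idx n) (Idx n) ℂ) a b •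
      wedge (Pi.single a 1) (Pi.single b 1) := by
    have hA : (x : Matrix (Idx n) (Idx n) ℂ).transpose = -x :=
      (LieAlgebra.Orthogonal.mem_so (Idx n) ℂ _).1 x.2
    have h1 : ∑ a, ∑ b, (x : Matrix (Idx n) (Idx n) ℂ) a b •
        (Matrix.single a b (1 : ℂ)) = x := by
      simpa [Matrix.smul_single] using (Matrix.matrix_eq_sum_single
        (x : Matrix (Idx n) (Idx n) ℂ)).symm
    have h2 : ∑ a, ∑ b, (x : Matrix (Idx n) (Idx n) ℂ) a b •
        (Matrix.single b a (1 : ℂ)) = -x := by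
      rw [← hA]
      nth_rewrite 2 [← h1]
      simp [Matrix.transpose_sum]
    apply Subtype.ext
    simp only [coe_smul, coe_sum, coe_wedge,
      ← Matrix.single_eq_single_vecMulVec_single, smul_sub, Finset.sum_sub_distrib, h1, h2]
    module
  rw [hx]
  exact Submodule.smul_mem _ _ (Submodule.sum_mem _ fun a _ => Submodule.sum_mem _ fun b _ =>
    Submodule.smul_mem _ _ (key _ _))

theorem stdWeight_add_cases (a b : Idx n) (hab : a ≠ b) :
    stdWeight a + stdWeight b ∈ posRoots n ∨ -(stdWeight a + stdWeight b) ∈ posRoots n ∨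
      (stdWeight a + stdWeight b = 0 ∧
        ∃ i, (a = xIdx i ∧ b = yIdx i) ∨ (a = yIdx i ∧ b = xIdx i)) := by
  have hlt : ∀ i j : Fin n, i ≠ j → L i + L j ∈ posRoots n := fun i j h => by
    rcases lt_or_gt_of_ne h with h | h
    · exact Or.inl ⟨i, j, h, Or.inr rfl⟩
    · exact Or.inl ⟨j, i, h, Or.inr (add_comm _ _)⟩
  have hsub : ∀ i j : Fin n, i ≠ j → L i - L j ∈ posRoots n ∨ L j - L i ∈ posRoots n :=
    fun i j h => by
      rcases lt_or_gt_of_ne h with h | h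
      · exact Or.inl (Or.inl ⟨i, j, h, Or.inl rfl⟩)
      · exact Or.inr (Or.inl ⟨j, i, h, Or.inl rfl⟩)
  rcases a with a | i | i <;> rcases b with b | j | j
  · exact absurd rfl hab
  · exact Or.inl (Or.inr ⟨j, by simp [stdWeight]⟩)
  · exact Or.inr (Or.inl (Or.inr ⟨j, by simp [stdWeight]⟩))
  · exact Or.inl (Or.inr ⟨i, by simp [stdWeight]⟩)
  · exact Or.inl (hlt i j fun h => hab (by rw [h]))
  · by_cases hij : i = j
    · subst hij
      exact Or.inr (Or.inr ⟨by simp [stdWeight], i, Or.inl ⟨rfl, rfl⟩⟩)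
    · simp only [stdWeight, ← sub_eq_add_neg, neg_sub]
      exact (hsub i j hij).imp_right Or.inl
  · exact Or.inr (Or.inl (Or.inr ⟨i, by simp [stdWeight]⟩))
  · by_cases hij : i = j
    · subst hij
      exact Or.inr (Or.inr ⟨by simp [stdWeight], i, Or.inr ⟨rfl, rfl⟩⟩)
    · simp only [stdWeight, neg_add_eq_sub, neg_sub]
      exact (hsub j i (Ne.symm hij)).imp_right Or.inl
  · refine Or.inr (Or.inl ?_)
    simp only [stdWeight, neg_add, neg_neg]
    exact hlt i j fun h => hab (by rw [h])

theorem toComplex_rot_eq (i : Fin n) :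
    (toComplex (rot i) : LieGC n) = (I / 2) • rootVec (xIdx i) (yIdx i) := by
  apply Subtype.ext
  have h : rootVec (xIdx i) (yIdx i) =
      (2 * I) • wedge (Pi.single (xIdx i) 1) (Pi.single (yIdx i) 1) := by
    have hswap : wedge (Pi.single (yIdx i) (1 : ℂ)) (Pi.single (xIdx i) 1) =
        -wedge (Pi.single (xIdx i) 1) (Pi.single (yIdx i) 1) :=
      Subtype.ext (neg_sub _ _).symm
    change wedgeₗ n (Pi.single (xIdx i) 1 - I • Pi.single (yIdx i) 1)
      (Pi.single (xIdx i) 1 + I • Pi.single (yIdx i) 1) = _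
    simp only [map_sub, map_add, map_smul, LinearMap.sub_apply, LinearMap.smul_apply,
      wedgeₗ_apply, wedge_self, hswap]
    module
  have h2 : (I / 2) * (2 * I) = -1 := by
    rw [← I_mul_I]; ring
  rw [h, smul_smul, h2, coe_toComplex_rot, coe_smul, coe_wedge,
    ← Matrix.single_eq_single_vecMulVec_single, ← Matrix.single_eq_single_vecMulVec_single]
  module

theorem toComplex_torus_lie (ξ ζ : torus n) :
    ⁅toComplex (ξ : LieG n), (toComplex (ζ : LieG n) : LieGC n)⁆ = 0 := by
  rw [toComplex_torus ζ, lie_sum]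
  refine Finset.sum_eq_zero fun i _ => ?_
  have h : ((coord ζ i) • toComplex (rot i) : LieGC n) = ((coord ζ i : ℝ) : ℂ) • toComplex (rot i) :=
    rfl
  rw [h, toComplex_rot_eq, lie_smul, lie_smul, torus_lie_rootVec]
  simp [stdWeight]

theorem rootVec_mem_rootSpace (a b : Idx n) : rootVec a b ∈ rootSpace (stdWeight a + stdWeight b) :=
  fun ξ => torus_lie_rootVec ξ a b

/-- The triangular decomposition in the form of an induction principle: each spanning root vector is
zero, belongs to a positive or negative root, or is a multiple of some `E_i`. -/
theorem lieGC_induction {p : LieGC n → Prop} (zero : p 0) (add : ∀ x y, p x → p y → p (x + y))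
    (smul : ∀ (c : ℂ) x, p x → p (c • x)) (torus : ∀ ξ : torus n, p (toComplex (ξ : LieG n)))
    (pos : ∀ α ∈ posRoots n, ∀ x ∈ rootSpace α, p x)
    (neg : ∀ α ∈ posRoots n, ∀ x ∈ rootSpace (-α), p x) (x : LieGC n) : p x := by
  have hx : x ∈ Submodule.span ℂ (Set.range fun q : Idx n × Idx n => rootVec q.1 q.2) := by
    rw [span_rootVec]; trivial
  have hxy : ∀ i : Fin n, p (rootVec (xIdx i) (yIdx i)) := fun i => by
    have h : rootVec (xIdx i) (yIdx i) = (-2 * I) • toComplex (rot i) := by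
      have h2 : (-2 * I) * (I / 2) = 1 := by
        linear_combination -I_mul_I
      rw [toComplex_rot_eq, smul_smul, h2, one_smul]
    rw [h]
    exact smul _ _ (torus (E i))
  induction hx using Submodule.span_induction with
  | zero => exact zero
  | add x y _ _ hx hy => exact add x y hx hy
  | smul c x _ hx => exact smul c x hx
  | mem x hx =>
    obtain ⟨⟨a, b⟩, rfl⟩ := hx
    change p (rootVec a b)
    by_cases hab : a = b
    · rw [hab, rootVec, wedge_self]
      exact zero
    rcases stdWeight_add_cases a b hab with h | h | ⟨-, i, ⟨rfl, rfl⟩ | ⟨rfl, rfl⟩⟩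
    · exact pos _ h _ (rootVec_mem_rootSpace a b)
    · exact neg _ h _ (by rw [neg_neg]; exact rootVec_mem_rootSpace a b)
    · exact hxy i
    · have h : rootVec (yIdx i) (xIdx i) = (-1 : ℂ) • rootVec (xIdx i) (yIdx i) := by
        rw [neg_one_smul]
        exact Subtype.ext (neg_sub _ _).symm
      rw [h]
      exact smul _ _ (hxy i)

/-! ### The integer lattice -/

/-- The generators of the Clifford algebra. -/
def gen (a : Idx n) : CliffordAlgebra (stdForm n) := CliffordAlgebra.ι (stdForm n) (Pi.single a 1)

theorem gen_mul_self (a : Idx n) : gen a * gen a = 1 := by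
  rw [gen, CliffordAlgebra.ι_sq_scalar]
  simp [QuadraticMap.weightedSumSquares_apply, Pi.single_apply]

theorem gen_isOrtho {a b : Idx n} (h : a ≠ b) :
    (stdForm n).IsOrtho (Pi.single a 1) (Pi.single b 1) := by
  rw [QuadraticMap.isOrtho_def]
  simp only [QuadraticMap.weightedSumSquares_apply, ← Finset.sum_add_distrib]
  refine Finset.sum_congr rfl fun c _ => ?_
  by_cases h1 : c = a
  · subst h1; simp [h]
  · simp [h1]

theorem gen_mul_comm {a b : Idx n} (h : a ≠ b) : gen a * gen b = -(gen b * gen a) :=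
  CliffordAlgebra.ι_mul_ι_comm_of_isOrtho (gen_isOrtho h)

/-- The bivector `e_{y_i} e_{x_i}` generating the rotations of the `i`-th coordinate plane. -/
def bivec (i : Fin n) : CliffordAlgebra (stdForm n) := gen (yIdx i) * gen (xIdx i)

theorem bivec_mul_self (i : Fin n) : bivec i * bivec i = -1 := by
  have h : gen (xIdx i) * gen (yIdx i) = -(gen (yIdx i) * gen (xIdx i)) := gen_mul_comm (by simp)
  calc bivec i * bivec i = gen (yIdx i) * (gen (xIdx i) * gen (yIdx i)) * gen (xIdx i) := by
        simp only [bivec, mul_assoc]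
    _ = -((gen (yIdx i) * gen (yIdx i)) * (gen (xIdx i) * gen (xIdx i))) := by
        rw [h]; simp only [mul_neg, neg_mul, mul_assoc]
    _ = -1 := by rw [gen_mul_self, gen_mul_self, one_mul]

theorem gen_commute_bivec {a : Idx n} {i : Fin n} (hx : a ≠ xIdx i) (hy : a ≠ yIdx i) :
    Commute (gen a) (bivec i) := by
  change gen a * (gen _ * gen _) = gen _ * gen _ * gen a
  rw [← mul_assoc, gen_mul_comm hy, neg_mul, mul_assoc, gen_mul_comm hx, mul_neg, neg_neg,
    mul_assoc]

theorem gen_mul_bivec (i : Fin n) : gen (xIdx i) * bivec i = -(bivec i * gen (xIdx i)) := by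
  rw [bivec, ← mul_assoc, gen_mul_comm (b := yIdx i) (by simp), neg_mul]

theorem bivec_commute (i j : Fin n) : Commute (bivec i) (bivec j) := by
  by_cases h : i = j
  · rw [h]
  · exact (gen_commute_bivec (by simp) (by simp [h])).mul_left
      (gen_commute_bivec (by simp [h]) (by simp))

/-- The rotor `cos s + sin s e_{y_i} e_{x_i}`. -/
def rotor (i : Fin n) (s : ℝ) : CliffordAlgebra (stdForm n) :=
  Real.cos s • 1 + Real.sin s • bivec i

theorem rotor_zero (i : Fin n) : rotor i 0 = 1 := by simp [rotor]

theorem rotor_add (i : Fin n) (s t : ℝ) : rotor i (s + t) = rotor i s * rotor i t := by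
  simp only [rotor, Real.cos_add, Real.sin_add, mul_add, add_mul, smul_mul_smul_comm, one_mul,
    mul_one, bivec_mul_self]
  module

theorem commute_rotor {X : CliffordAlgebra (stdForm n)} {i : Fin n} (h : Commute X (bivec i))
    (s : ℝ) : Commute X (rotor i s) :=
  ((Commute.one_right X).smul_right _).add_right (h.smul_right _)

theorem rotor_commute (i j : Fin n) (s t : ℝ) : Commute (rotor i s) (rotor j t) :=
  commute_rotor (commute_rotor (bivec_commute j i) s).symm t

/-- The vector `e_{x_i}` anticommutes with the `i`-th bivector and commutes with the others, so
conjugation by it reverses the `i`-th angle only. -/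
theorem gen_mul_rotor (i j : Fin n) (s : ℝ) :
    gen (xIdx i) * rotor j s = rotor j (if j = i then -s else s) * gen (xIdx i) := by
  split_ifs with h
  · subst h
    simp only [rotor, mul_add, add_mul, mul_smul_comm, smul_mul_assoc, gen_mul_bivec, mul_one,
      one_mul, Real.cos_neg, Real.sin_neg]
    module
  · exact commute_rotor (gen_commute_bivec (by simp [Ne.symm h]) (by simp)) s

/-- The product of the rotors with angles `φ i` for `i` in a list. -/
def rotors (l : List (Fin n)) (φ : Fin n → ℝ) : CliffordAlgebra (stdForm n) :=
  (l.map fun i => rotor i (φ i)).prod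

theorem rotors_cons (i : Fin n) (l : List (Fin n)) (φ : Fin n → ℝ) :
    rotors (i :: l) φ = rotor i (φ i) * rotors l φ := by simp [rotors]

theorem rotors_zero (l : List (Fin n)) : rotors l 0 = 1 := by
  simp [rotors, rotor_zero]

theorem rotors_add (l : List (Fin n)) (φ ψ : Fin n → ℝ) :
    rotors l (φ + ψ) = rotors l φ * rotors l ψ := by
  induction l with
  | nil => simp [rotors]
  | cons i l ih =>
    have h : Commute (rotor i (ψ i)) (rotors l φ) := Commute.list_prod_right _ _ fun x hx => by
      obtain ⟨j, _, rfl⟩ := List.mem_map.1 hx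
      exact rotor_commute _ _ _ _
    rw [rotors_cons, rotors_cons, rotors_cons, ih, Pi.add_apply, rotor_add, mul_assoc,
      ← mul_assoc (rotor i (ψ i)), h.eq, mul_assoc, mul_assoc]

theorem gen_mul_rotors (i : Fin n) (l : List (Fin n)) (φ : Fin n → ℝ) :
    gen (xIdx i) * rotors l φ =
      rotors l (fun j => if j = i then -φ j else φ j) * gen (xIdx i) := by
  induction l with
  | nil => simp [rotors]
  | cons j l ih => rw [rotors_cons, rotors_cons, ← mul_assoc, gen_mul_rotor, mul_assoc, ih, mul_assoc]

/-! ### One-parameter subgroups in the Clifford algebra -/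

/-- Weak form of the differential equation `γ' = γ X`. -/
def WeakODE (γ : ℝ → CliffordAlgebra (stdForm n)) (X : CliffordAlgebra (stdForm n)) : Prop :=
  ∀ (f : CliffordAlgebra (stdForm n) →ₗ[ℝ] ℝ) (t : ℝ),
    HasDerivAt (fun t => f (γ t)) (f (γ t * X)) t

/-- The product rule. The rotor is a scalar combination of `1` and the bivector, so testing against
`f` and `f` composed with right multiplication by the bivector involves only real functions. -/
theorem WeakODE.mul_rotor {γ : ℝ → CliffordAlgebra (stdForm n)} {X : CliffordAlgebra (stdForm n)}
    (h : WeakODE γ X) {i : Fin n} (hX : Commute X (bivec i)) (a : ℝ) :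
    WeakODE (fun t => γ t * rotor i (a * t)) (X + a • bivec i) := by
  intro f t
  have hlin : HasDerivAt (fun t : ℝ => a * t) a t := by
    simpa using (hasDerivAt_id t).const_mul a
  have h1 := hlin.cos.mul (h f t)
  have h2 := hlin.sin.mul (h (f ∘ₗ LinearMap.mulRight ℝ (bivec i)) t)
  have h3 : γ t * rotor i (a * t) * (X + a • bivec i) =
      (-Real.sin (a * t) * a) • γ t + Real.cos (a * t) • (γ t * X) +
      ((Real.cos (a * t) * a) • (γ t * bivec i) + Real.sin (a * t) • (γ t * X * bivec i)) := by
    rw [mul_assoc (γ t) X, hX.eq]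
    simp only [rotor, mul_add, add_mul, smul_mul_assoc, mul_smul_comm, mul_one, mul_assoc,
      bivec_mul_self, mul_neg]
    module
  have h4 : (fun t => f (γ t * rotor i (a * t))) =
      ((fun x => Real.cos (a * x)) * fun t => f (γ t)) +
      (fun x => Real.sin (a * x)) * fun t => (f ∘ₗ LinearMap.mulRight ℝ (bivec i)) (γ t) := by
    funext t
    simp [rotor, mul_add]
  change HasDerivAt (fun t => f (γ t * rotor i (a * t))) (f (γ t * rotor i (a * t) * _)) t
  rw [h4, h3]
  exact (h1.add h2).congr_deriv (by simp)

theorem WeakODE.mul_rotors (l : List (Fin n)) {γ : ℝ → CliffordAlgebra (stdForm n)}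
    {X : CliffordAlgebra (stdForm n)} (h : WeakODE γ X) (hX : ∀ i, Commute X (bivec i))
    (θ : Fin n → ℝ) :
    WeakODE (fun t => γ t * rotors l (fun i => θ i * t))
      (X + (l.map fun i => θ i • bivec i).sum) := by
  induction l generalizing γ X with
  | nil => simpa [rotors] using h
  | cons i l ih =>
    have := ih (h.mul_rotor (hX i) (θ i))
      (fun j => (hX j).add_left ((bivec_commute i j).smul_left _))
    simpa only [rotors_cons, ← mul_assoc, List.map_cons, List.sum_cons, ← add_assoc] using this

theorem WeakODE.eq_of_zero {γ : ℝ → CliffordAlgebra (stdForm n)} (h : WeakODE γ 0) (s t : ℝ) :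
    γ s = γ t := by
  rw [← sub_eq_zero, ← Module.forall_dual_apply_eq_zero_iff ℝ]
  intro f
  rw [map_sub, sub_eq_zero]
  refine is_const_of_deriv_eq_zero (f := fun t => f (γ t)) (fun u => (h f u).differentiableAt)
    (fun u => ?_) s t
  rw [(h f u).deriv, mul_zero, map_zero]

/-- Composing functionals with left multiplication by `γ t` transports the derivative at 0 to `t`.
-/
theorem weakODE_of_add {γ : ℝ → CliffordAlgebra (stdForm n)} {X : CliffordAlgebra (stdForm n)}
    (hγ : ∀ s t, γ (s + t) = γ s * γ t)
    (h : ∀ f : CliffordAlgebra (stdForm n) →ₗ[ℝ] ℝ, HasDerivAt (fun t => f (γ t)) (f X) 0) :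
    WeakODE γ X := by
  intro f t
  have h1 := h (f ∘ₗ LinearMap.mulLeft ℝ (γ t))
  have h2 : HasDerivAt (fun s => f (γ (t + s))) (f (γ t * X)) 0 := by
    simpa [hγ] using h1
  have h3 := HasDerivAt.comp_sub_const (f := fun s => f (γ (t + s))) t t (by simpa using h2)
  simpa using h3

/-- `toClifford` as a linear map. -/
def toCliffordₗ (n : ℕ) : LieG n →ₗ[ℝ] CliffordAlgebra (stdForm n) where
  toFun := toClifford
  map_add' X Y := by
    have (a b : Idx n) : ((X + Y : LieG n) : Matrix (Idx n) (Idx n) ℝ) a b =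
      (X : Matrix (Idx n) (Idx n) ℝ) a b + (Y : Matrix (Idx n) (Idx n) ℝ) a b := rfl
    simp only [toClifford, this, add_smul, Finset.sum_add_distrib, smul_add]
  map_smul' c X := by
    have (a b : Idx n) : ((c • X : LieG n) : Matrix (Idx n) (Idx n) ℝ) a b =
      c * (X : Matrix (Idx n) (Idx n) ℝ) a b := rfl
    simp only [toClifford, this, mul_smul, ← Finset.smul_sum, RingHom.id_apply]
    rw [smul_comm]

/-- The factor `1/2` is the double covering: a rotation by angle `θ` lifts to a rotor with angle `θ
/ 2`. Hence the angles for `2πξ` are `π` times the coordinates. -/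
theorem toClifford_rot (i : Fin n) : toClifford (rot i) = (1 / 2 : ℝ) • bivec i := by
  have h : ∀ a b : Idx n, (rot i : Matrix (Idx n) (Idx n) ℝ) a b =
      (if a = yIdx i then if b = xIdx i then 1 else 0 else 0) -
        (if a = xIdx i then if b = yIdx i then 1 else 0 else 0) := fun a b => by
    change (Matrix.single (yIdx i) (xIdx i) (1 : ℝ) - Matrix.single (xIdx i) (yIdx i) 1 :
      Matrix (Idx n) (Idx n) ℝ) a b = _
    simp only [Matrix.sub_apply, Matrix.single_apply, ← ite_and, eq_comm]
  have h2 : gen (xIdx i) * gen (yIdx i) = -(gen (yIdx i) * gen (xIdx i)) := gen_mul_comm (by simp)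
  simp only [toClifford, h, sub_smul, ite_smul, one_smul, zero_smul, Finset.sum_sub_distrib]
  change (1 / 4 : ℝ) • ((∑ a, ∑ b, if a = yIdx i then if b = xIdx i then gen a * gen b else 0 else 0)
    - ∑ a, ∑ b, if a = xIdx i then if b = yIdx i then gen a * gen b else 0 else 0) = _
  have h3 : ∀ c d : Idx n, (∑ a, ∑ b, if a = c then if b = d then gen a * gen b else 0 else 0) =
      gen c * gen d := fun c d => by
    rw [Finset.sum_eq_single c (fun a _ ha => by simp [ha]) (by simp)]
    simp
  rw [h3, h3, h2, bivec]
  module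

theorem toClifford_torus (ξ : torus n) :
    toClifford ((2 * Real.pi) • (ξ : LieG n)) =
      ((List.finRange n).map fun i => (Real.pi * coord ξ i) • bivec i).sum := by
  have h : ((ξ : torus n) : LieG n) = ∑ i, coord ξ i • rot i := by
    conv_lhs => rw [eq_sum_coord ξ]
    simp [E]
  rw [h, ← Fin.sum_univ_def]
  change toCliffordₗ n _ = _
  rw [map_smul, map_sum, Finset.smul_sum]
  refine Finset.sum_congr rfl fun i _ => ?_
  rw [map_smul]
  change (2 * Real.pi) • coord ξ i • toClifford (rot i) = _
  rw [toClifford_rot]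
  module

/-- A rotor is the product of the two unit vectors `e_{y_i}` and `cos s e_{y_i} + sin s e_{x_i}`. -/
theorem rotor_mem_spinGroup (i : Fin n) (s : ℝ) : rotor i s ∈ spinGroup (stdForm n) := by
  have h2 : gen (xIdx i) * gen (yIdx i) = -(gen (yIdx i) * gen (xIdx i)) := gen_mul_comm (by simp)
  have hr : rotor i s = gen (yIdx i) * (Real.cos s • gen (yIdx i) + Real.sin s • gen (xIdx i)) := by
    simp only [rotor, mul_add, mul_smul_comm, gen_mul_self, bivec]
  have hι : Real.cos s • gen (yIdx i) + Real.sin s • gen (xIdx i) = CliffordAlgebra.ι (stdForm n)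
      (Real.cos s • Pi.single (yIdx i) 1 + Real.sin s • Pi.single (xIdx i) 1) := by
    simp [gen]
  have hv : (Real.cos s • gen (yIdx i) + Real.sin s • gen (xIdx i)) *
      (Real.cos s • gen (yIdx i) + Real.sin s • gen (xIdx i)) = 1 := by
    simp only [mul_add, add_mul, smul_mul_smul_comm, gen_mul_self, h2]
    have : (Real.cos s * Real.cos s + Real.sin s * Real.sin s) • (1 : CliffordAlgebra (stdForm n))
        = 1 := by
      rw [← sq, ← sq, Real.cos_sq_add_sin_sq, one_smul]
    calc _ = (Real.cos s * Real.cos s + Real.sin s * Real.sin s) •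
          (1 : CliffordAlgebra (stdForm n)) := by module
      _ = 1 := this
  have hstar : star (rotor i s) = rotor i (-s) := by
    simp only [rotor, star_add, CliffordAlgebra.star_smul, star_one, bivec, star_mul, gen,
      CliffordAlgebra.star_ι, Real.cos_neg, Real.sin_neg, neg_mul_neg]
    change _ + Real.sin s • (gen (xIdx i) * gen (yIdx i)) =
      _ + -Real.sin s • (gen (yIdx i) * gen (xIdx i))
    rw [h2]
    module
  rw [spinGroup.mem_iff, pinGroup.mem_iff]
  refine ⟨⟨?_, ?_⟩, ?_⟩
  · refine ⟨⟨gen (yIdx i), gen (yIdx i), gen_mul_self _, gen_mul_self _⟩ *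
      ⟨_, _, hv, hv⟩, ?_, hr.symm⟩
    exact mul_mem (Subgroup.subset_closure ⟨_, rfl⟩) (Subgroup.subset_closure ⟨_, hι.symm⟩)
  · rw [Unitary.mem_iff, hstar, ← rotor_add, ← rotor_add]
    simp [rotor_zero]
  · rw [← Subalgebra.mem_toSubmodule, CliffordAlgebra.even_toSubmodule, hr, hι]
    exact CliffordAlgebra.ι_mul_ι_mem_evenOdd_zero _ _ _

theorem rotors_mem_spinGroup (l : List (Fin n)) (φ : Fin n → ℝ) :
    rotors l φ ∈ spinGroup (stdForm n) :=
  Submonoid.list_prod_mem _ fun x hx => by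
    obtain ⟨j, _, rfl⟩ := List.mem_map.1 hx
    exact rotor_mem_spinGroup _ _

/-- One-parameter subgroups are unique: multiplying a given one by the rotors with opposite angles
leaves a curve with zero derivative. Conversely the rotors themselves form the required subgroup. -/
theorem isExp_iff (ξ : torus n) : IsExp ((2 * Real.pi) • (ξ : LieG n)) (1 : Spin n) ↔
    rotors (List.finRange n) (fun i => Real.pi * coord ξ i) = 1 := by
  constructor
  · rintro ⟨γ, hadd, hder, h1⟩
    have h0 : γ 0 = 1 := by
      have := hadd 0 0
      rw [add_zero] at this
      exact left_eq_mul.1 this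
    have hode : WeakODE (fun t => (γ t : CliffordAlgebra (stdForm n)))
        (toClifford ((2 * Real.pi) • (ξ : LieG n))) :=
      weakODE_of_add (fun s t => by rw [hadd]; rfl) hder
    have hcomm : ∀ i, Commute (toClifford ((2 * Real.pi) • (ξ : LieG n))) (bivec i) := fun i => by
      rw [toClifford_torus]
      refine Commute.symm (Commute.list_sum_right _ _ fun x hx => ?_)
      obtain ⟨j, _, rfl⟩ := List.mem_map.1 hx
      exact (bivec_commute _ _).smul_right _
    have h2 := hode.mul_rotors (List.finRange n) hcomm (fun i => -(Real.pi * coord ξ i))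
    have h3 : toClifford ((2 * Real.pi) • (ξ : LieG n)) +
        ((List.finRange n).map fun i => (-(Real.pi * coord ξ i)) • bivec i).sum = 0 := by
      rw [toClifford_torus, ← Fin.sum_univ_def, ← Fin.sum_univ_def]
      simp
    rw [h3] at h2
    have h4 := h2.eq_of_zero 1 0
    simp only [h0, h1, OneMemClass.coe_one, one_mul, mul_one, mul_zero] at h4
    have h5 : rotors (List.finRange n) (fun _ : Fin n => (0 : ℝ)) = 1 := rotors_zero _
    rw [h5] at h4
    have h6 := rotors_add (List.finRange n) (fun i => -(Real.pi * coord ξ i))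
      (fun i => Real.pi * coord ξ i)
    rw [h4, one_mul] at h6
    rw [← h6]
    convert rotors_zero (List.finRange n) using 2
    ext i
    simp
  · intro h
    have hode : WeakODE (fun _ => (1 : CliffordAlgebra (stdForm n))) 0 := fun f t => by
      simpa using hasDerivAt_const t (f 1)
    have h2 := hode.mul_rotors (List.finRange n) (fun i => Commute.zero_left _)
      (fun i => Real.pi * coord ξ i)
    have h5 : rotors (List.finRange n) (fun _ : Fin n => (0 : ℝ)) = 1 := rotors_zero _
    refine ⟨fun t => ⟨rotors (List.finRange n) (fun i => Real.pi * coord ξ i * t),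
      rotors_mem_spinGroup _ _⟩, fun s t => Subtype.ext ?_, fun f => ?_, Subtype.ext ?_⟩
    · refine Eq.trans ?_ (rotors_add _ _ _)
      change rotors _ _ = rotors _ _
      congr 1
      funext i
      simp [mul_add]
    · have h3 := h2 f 0
      simpa [h5, toClifford_torus] using h3
    · simpa using h

theorem rotors_eq_smul_of_sin {l : List (Fin n)} {φ : Fin n → ℝ} (h : ∀ i, Real.sin (φ i) = 0) :
    rotors l φ = (l.map fun i => Real.cos (φ i)).prod • 1 := by
  induction l with
  | nil => simp [rotors]
  | cons i l ih =>
    rw [rotors_cons, ih, rotor, h, zero_smul, add_zero, smul_mul_smul_comm, one_mul,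
      List.map_cons, List.prod_cons]

theorem smul_one_injective {c d : ℝ}
    (h : c • (1 : CliffordAlgebra (stdForm n)) = d • 1) : c = d := by
  rw [← Algebra.algebraMap_eq_smul_one, ← Algebra.algebraMap_eq_smul_one] at h
  exact (algebraMap ℝ (CliffordAlgebra (stdForm n))).injective h

/-- If the product is 1, so is the product with the `i`-th angle reversed, by conjugation with
`e_{x_i}`. Their quotient is the single rotor of angle `2 φ i`, which is then 1, as is the rotor of
angle `-(2 φ i)`. In the sum of these two the bivector cancels, so only the injectivity of scalars
in the Clifford algebra is needed. -/
theorem cos_eq_one_of_rotors {φ : Fin n → ℝ} (h : rotors (List.finRange n) φ = 1) (i : Fin n) :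
    Real.cos (2 * φ i) = 1 := by
  have hcancel : ∀ ψ, rotors (List.finRange n) ψ = 1 →
      rotors (List.finRange n) (fun j => if j = i then -ψ j else ψ j) = 1 := fun ψ hψ => by
    have h1 := gen_mul_rotors i (List.finRange n) ψ
    rw [hψ, mul_one] at h1
    calc _ = rotors (List.finRange n) (fun j => if j = i then -ψ j else ψ j) *
          (gen (xIdx i) * gen (xIdx i)) := by rw [gen_mul_self, mul_one]
      _ = 1 := by rw [← mul_assoc, ← h1, gen_mul_self]
  have h2 := rotors_add (List.finRange n) (Pi.single i (2 * φ i))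
    (fun j => if j = i then -φ j else φ j)
  have h3 : (Pi.single i (2 * φ i) + fun j => if j = i then -φ j else φ j) = φ := by
    ext j
    by_cases hj : j = i
    · subst hj; simp; ring
    · simp [hj]
  rw [h3, h, hcancel φ h, mul_one] at h2
  have hsingle : ∀ s, rotors (List.finRange n) (Pi.single i s) = rotor i s := fun s => by
    rw [rotors, List.prod_map_eq_pow_single i]
    · rw [List.count_eq_one_of_mem (List.nodup_finRange n) (List.mem_finRange i)]
      simp
    · intro j hj _
      simp [hj, rotor_zero]
  have h4 := hcancel _ h2.symm
  have h5 : (fun j => if j = i then -(Pi.single i (2 * φ i) : Fin n → ℝ) j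
      else (Pi.single i (2 * φ i) : Fin n → ℝ) j) = Pi.single i (-(2 * φ i)) := by
    ext j
    by_cases hj : j = i
    · subst hj; simp
    · simp [hj]
  rw [h5, hsingle] at h4
  rw [hsingle] at h2
  have h6 : (2 * Real.cos (2 * φ i)) • (1 : CliffordAlgebra (stdForm n)) = (2 : ℝ) • 1 := by
    calc _ = rotor i (2 * φ i) + rotor i (-(2 * φ i)) := by
          simp only [rotor, Real.cos_neg, Real.sin_neg]; module
      _ = _ := by rw [← h2, h4]; module
  linarith [smul_one_injective h6]

/-- Integrality of the coordinates comes from `cos (2π m_i) = 1`. The rotors are then the signs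
`(-1) ^ m i`, whose product is 1 exactly for even sum. -/
theorem mem_integerLattice_iff (ξ : torus n) :
    ξ ∈ integerLattice n ↔ ∃ m : Fin n → ℤ, (∀ i, coord ξ i = m i) ∧ Even (∑ i, m i) := by
  have key : ∀ m : Fin n → ℤ, (∀ i, coord ξ i = m i) →
      (rotors (List.finRange n) (fun i => Real.pi * coord ξ i) = 1 ↔ Even (∑ i, m i)) := by
    intro m hm
    have hφ : (fun i => Real.pi * coord ξ i) = fun i => (m i : ℝ) * Real.pi := by
      ext i; rw [hm, mul_comm]
    rw [hφ, rotors_eq_smul_of_sin fun i => Real.sin_int_mul_pi _]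
    simp only [Real.cos_int_mul_pi]
    have hprod : ((List.finRange n).map fun i => (-1 : ℝ) ^ m i).prod = (-1) ^ ∑ i, m i := by
      rw [Fin.sum_univ_def]
      induction List.finRange n with
      | nil => simp
      | cons i l ih => rw [List.map_cons, List.prod_cons, ih, List.map_cons, List.sum_cons,
          zpow_add₀ (by norm_num)]
    rw [hprod]
    rcases Int.even_or_odd (∑ i, m i) with he | ho
    · simp [he, he.neg_one_zpow]
    · rw [ho.neg_one_zpow]
      refine ⟨fun h => ?_, fun h => absurd h (Int.not_even_iff_odd.2 ho)⟩
      have := smul_one_injective (h.trans (one_smul ℝ 1).symm)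
      norm_num at this
  change IsExp _ _ ↔ _
  rw [isExp_iff]
  constructor
  · intro h
    have : ∀ i, ∃ m : ℤ, coord ξ i = m := fun i => by
      obtain ⟨m, hm⟩ := (Real.cos_eq_one_iff _).1 (cos_eq_one_of_rotors h i)
      refine ⟨m, ?_⟩
      have := Real.pi_pos
      have h2 : (2 * Real.pi) * (m - coord ξ i) = 0 := by linarith
      rcases mul_eq_zero.1 h2 with h3 | h3 <;> linarith
    choose m hm using this
    exact ⟨m, hm, (key m hm).1 h⟩
  · rintro ⟨m, hm, he⟩
    exact (key m hm).2 he

/-! ### Canonical elements -/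

theorem coord_H (m : ℕ) (i : Fin n) : coord (H n m) i = if (i : ℕ) + 1 ≤ m then 1 else 0 := by
  rw [coord, L_H]; split_ifs <;> simp

/-- `coord` as a linear map. -/
def coordₗ (i : Fin n) : torus n →ₗ[ℝ] ℝ := Complex.imLm ∘ₗ L i

theorem coordₗ_apply (i : Fin n) (ξ : torus n) : coordₗ i ξ = coord ξ i := rfl

/-- The element `∑ c_k H_k` of the torus. -/
def combH (n : ℕ) (c : ℕ → ℝ) : torus n := ∑ k ∈ Finset.Icc 1 n, c k • H n k

theorem coord_combH (c : ℕ → ℝ) (i : Fin n) :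
    coord (combH n c) i = ∑ k ∈ Finset.Icc 1 n, if (i : ℕ) + 1 ≤ k then c k else 0 := by
  rw [← coordₗ_apply, combH, map_sum]
  refine Finset.sum_congr rfl fun k _ => ?_
  rw [map_smul, coordₗ_apply, coord_H]; simp

theorem simpleRoot_combH (c : ℕ → ℝ) (i : Fin n) :
    simpleRoot i (combH n c) = (c ((i : ℕ) + 1) : ℂ) * I := by
  rw [combH, map_sum, Finset.sum_eq_single ((i : ℕ) + 1)]
  · rw [map_smul, simpleRoot_H]; simp
  · intro k hk hki
    rw [Finset.mem_Icc] at hk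
    have := simpleRoot_H i (⟨k - 1, by omega⟩ : Fin n)
    rw [map_smul]
    simp only [Nat.sub_add_cancel hk.1] at this
    rw [this, if_neg, smul_zero]
    rintro rfl
    exact hki (by simp; omega)
  · intro h
    exact absurd (Finset.mem_Icc.2 ⟨by omega, i.2⟩) h

theorem combH_congr {c d : ℕ → ℝ} (h : ∀ k ∈ Finset.Icc 1 n, c k = d k) :
    combH n c = combH n d := Finset.sum_congr rfl fun k hk => by rw [h k hk]

theorem posRoot_H_nonneg {α : torus n →ₗ[ℝ] ℂ} (hα : α ∈ posRoots n) (m : ℕ) :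
    0 ≤ (α (H n m)).im := by
  rcases hα with ⟨i, j, hij, rfl | rfl⟩ | ⟨i, rfl⟩
  · have : (i : ℕ) < j := hij
    rw [LinearMap.sub_apply, L_H, L_H]
    split_ifs <;> first | omega | simp
  · rw [LinearMap.add_apply, L_H, L_H]
    split_ifs <;> simp
  · rw [L_H]
    split_ifs <;> simp

theorem posRoot_combH_nonneg {α : torus n →ₗ[ℝ] ℂ} (hα : α ∈ posRoots n) {c : ℕ → ℝ}
    (hc : ∀ k ∈ Finset.Icc 1 n, 0 ≤ c k) : 0 ≤ (α (combH n c)).im := by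
  rw [combH, map_sum, Complex.im_sum]
  refine Finset.sum_nonneg fun k hk => ?_
  rw [map_smul, Complex.smul_im]
  exact mul_nonneg (hc k hk) (posRoot_H_nonneg hα k)

theorem combH_sub (c d : ℕ → ℝ) : combH n c - combH n d = combH n (fun k => c k - d k) := by
  simp only [combH, ← Finset.sum_sub_distrib, sub_smul]

/-- The coefficient functions of the elements of the integer lattice in the cone of `S`. -/
def Admissible (n : ℕ) (S : Finset ℕ) (c : ℕ → ℕ) : Prop :=
  (∀ k ∈ Finset.Icc 1 n, c k = 0 ↔ k ∉ S) ∧ Even (∑ k ∈ Finset.Icc 1 n, k * c k)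

theorem coord_combH_nat (c : ℕ → ℕ) (i : Fin n) : coord (combH n fun k => (c k : ℝ)) i =
    ((∑ k ∈ Finset.Icc 1 n, if (i : ℕ) + 1 ≤ k then c k else 0 : ℕ) : ℤ) := by
  rw [coord_combH]; push_cast; rfl

/-- Exchange of sums: `H_k` has exactly `k` coordinates equal to 1. -/
theorem sum_sum_ite (c : ℕ → ℕ) :
    ∑ i : Fin n, (∑ k ∈ Finset.Icc 1 n, if (i : ℕ) + 1 ≤ k then c k else 0) =
      ∑ k ∈ Finset.Icc 1 n, k * c k := by
  rw [Finset.sum_comm]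
  refine Finset.sum_congr rfl fun k hk => ?_
  rw [Finset.mem_Icc] at hk
  rw [Fin.sum_univ_eq_sum_range (fun i => if i + 1 ≤ k then c k else 0), ← Finset.sum_filter,
    Finset.sum_const, smul_eq_mul]
  congr 1
  have : (Finset.range n).filter (fun i => i + 1 ≤ k) = Finset.range k := by
    ext i; simp only [Finset.mem_filter, Finset.mem_range]; omega
  rw [this, Finset.card_range]

/-- The coefficient of `H_k` is the value of the `k`-th simple root, a difference of two coordinates
or the last coordinate, hence an integer on the lattice. Dominance is automatic in the cone. -/
theorem mem_dominantLattice_inter_cone_iff (S : Finset ℕ) (ξ : torus n) :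
    ξ ∈ dominantLattice n ∩ cone n S ↔
      ∃ c : ℕ → ℕ, Admissible n S c ∧ ξ = combH n fun k => (c k : ℝ) := by
  constructor
  · rintro ⟨⟨hlat, _⟩, c, hc, hξ⟩
    obtain ⟨m, hm, heven⟩ := (mem_integerLattice_iff ξ).1 hlat
    have hint : ∀ k ∈ Finset.Icc 1 n, ∃ d : ℕ, c k = d := fun k hk => by
      have h0 := (hc k hk).1
      rw [Finset.mem_Icc] at hk
      have h1 := simpleRoot_combH c (⟨k - 1, by omega⟩ : Fin n)
      have h2 : ∃ z : ℤ, (simpleRoot (⟨k - 1, by omega⟩ : Fin n) ξ).im = z := by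
        unfold simpleRoot
        split_ifs with h
        · exact ⟨m ⟨k - 1, by omega⟩ - m ⟨k - 1 + 1, h⟩, by
            push_cast
            rw [LinearMap.sub_apply, Complex.sub_im, ← hm, ← hm]; rfl⟩
        · exact ⟨m ⟨k - 1, by omega⟩, by rw [← hm]; rfl⟩
      obtain ⟨z, hz⟩ := h2
      have h3 : c k = z := by
        rw [← hz, hξ]
        change _ = (simpleRoot _ (combH n c)).im
        rw [h1]
        simp [Nat.sub_add_cancel hk.1]
      have h4 : 0 ≤ z := by rw [h3] at h0; exact_mod_cast h0
      exact ⟨z.toNat, by rw [h3]; exact_mod_cast (Int.toNat_of_nonneg h4).symm⟩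
    choose! d hd using hint
    have hξ' : ξ = combH n fun k => (d k : ℝ) := hξ.trans (combH_congr hd)
    refine ⟨d, ⟨fun k hk => ?_, ?_⟩, hξ'⟩
    · rw [← (hc k hk).2, hd k hk, Nat.cast_eq_zero]
    · have : ∀ i, m i =
          ((∑ k ∈ Finset.Icc 1 n, if (i : ℕ) + 1 ≤ k then d k else 0 : ℕ) : ℤ) := fun i => by
        have h1 := hm i
        rw [hξ', coord_combH_nat] at h1
        exact_mod_cast h1.symm
      simp only [this] at heven
      rw [← Nat.cast_sum, sum_sum_ite] at heven
      exact_mod_cast heven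
  · rintro ⟨c, ⟨hc, heven⟩, rfl⟩
    refine ⟨⟨(mem_integerLattice_iff _).2 ⟨_, coord_combH_nat c, ?_⟩, fun α hα =>
      posRoot_combH_nonneg hα fun k _ => Nat.cast_nonneg _⟩, fun k => (c k : ℝ),
      fun k hk => ⟨Nat.cast_nonneg _, ?_⟩, rfl⟩
    · rw [← Nat.cast_sum, sum_sum_ite]
      exact_mod_cast heven
    · rw [Nat.cast_eq_zero, hc k hk]

/-! ### The relation `≼` on coefficients -/

theorem mem_gradedPart_iff (ξ : torus n) (j : ℤ) (x : LieGC n) :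
    x ∈ gradedPart ξ j ↔ ⁅toComplex (ξ : LieG n), x⁆ = ((j : ℂ) * I) • x := by
  rw [gradedPart, Module.End.mem_eigenspace_iff, LieAlgebra.ad_apply]

theorem rootVec_mem_gradedPart {ξ : torus n} {j : ℤ} {a b : Idx n}
    (h : (stdWeight a + stdWeight b) ξ = j * I) : rootVec a b ∈ gradedPart ξ j := by
  rw [mem_gradedPart_iff, torus_lie_rootVec, h]

theorem gradedPart_le_filteredPart (ξ : torus n) {i j : ℤ} (h : j ≤ i) :
    gradedPart ξ j ≤ filteredPart ξ i := le_iSup₂_of_le j h le_rfl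

/-- Eigenspaces for distinct eigenvalues are independent, so a nonzero homogeneous vector has a
well-defined degree. -/
theorem le_of_mem_filteredPart {ξ : torus n} {i j : ℤ} {x : LieGC n} (hx : x ≠ 0)
    (hj : x ∈ gradedPart ξ j) (hi : x ∈ filteredPart ξ i) : j ≤ i := by
  by_contra hlt
  have hind := Module.End.eigenspaces_iSupIndep
    (LieAlgebra.ad ℂ (LieGC n) (toComplex (ξ : LieG n)) : Module.End ℂ (LieGC n))
  refine hx ((Submodule.disjoint_def.1 (hind ((j : ℂ) * I))) x hj ?_)
  refine (iSup₂_le fun k hk => ?_ : filteredPart ξ i ≤ _) hi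
  refine le_iSup₂_of_le ((k : ℂ) * I) ?_ le_rfl
  intro h
  have := mul_right_cancel₀ I_ne_zero h
  have : k = j := by exact_mod_cast this
  omega

theorem eigenspace_le_span {κ M : Type*} [AddCommGroup M] [Module ℂ M] (T : Module.End ℂ M)
    (v : κ → M) (ν : κ → ℂ) (hv : ∀ k, T (v k) = ν k • v k)
    (hspan : Submodule.span ℂ (Set.range v) = ⊤) (μ : ℂ) :
    T.eigenspace μ ≤ Submodule.span ℂ (v '' {k | ν k = μ}) := by
  intro x hx
  have htop : x ∈ Submodule.span ℂ (v '' {k | ν k = μ}) ⊔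
      Submodule.span ℂ (v '' {k | ν k ≠ μ}) := by
    rw [← Submodule.span_union, ← Set.image_union]
    have : {k | ν k = μ} ∪ {k | ν k ≠ μ} = Set.univ := by
      ext k; simp [em]
    rw [this, Set.image_univ, hspan]
    trivial
  obtain ⟨y, hy, z, hz, rfl⟩ := Submodule.mem_sup.1 htop
  have hy' : y ∈ T.eigenspace μ := by
    refine (Submodule.span_le.2 ?_ : Submodule.span ℂ (v '' {k | ν k = μ}) ≤ _) hy
    rintro _ ⟨k, hk, rfl⟩
    exact Module.End.mem_eigenspace_iff.2 (by rw [hv, hk])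
  have hz1 : z ∈ T.eigenspace μ := by
    have := Submodule.sub_mem _ hx hy'
    rwa [add_sub_cancel_left] at this
  have hz2 : z ∈ ⨆ ν', ⨆ (_ : ν' ≠ μ), T.eigenspace ν' := by
    refine (Submodule.span_le.2 ?_ : Submodule.span ℂ (v '' {k | ν k ≠ μ}) ≤ _) hz
    rintro _ ⟨k, hk, rfl⟩
    exact Submodule.mem_iSup_of_mem (ν k) (Submodule.mem_iSup_of_mem hk
      (Module.End.mem_eigenspace_iff.2 (hv k)))
  rw [Submodule.disjoint_def.1 (T.eigenspaces_iSupIndep μ) z hz1 hz2, add_zero]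
  exact hy

theorem exists_rootVec_simpleRoot (i : Fin n) : ∃ a b : Idx n,
    stdWeight a + stdWeight b = simpleRoot i ∧ rootVec a b ≠ 0 := by
  have hentry : ∀ a b r s, rootVec a b = 0 →
      stdVec a r * stdVec b s - stdVec b r * stdVec a s = (0 : ℂ) := fun a b r s h =>
    congrFun (congrFun (congrArg (fun x : LieGC n => (x : Matrix (Idx n) (Idx n) ℂ)) h) r) s
  unfold simpleRoot
  split_ifs with h
  · refine ⟨xIdx i, yIdx ⟨i + 1, h⟩, by simp [stdWeight, sub_eq_add_neg], fun h0 => ?_⟩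
    have hne : i ≠ ⟨i + 1, h⟩ := fun h => by simpa using congrArg Fin.val h
    have := hentry _ _ (xIdx i) (xIdx ⟨i + 1, h⟩) h0
    simp [stdVec, hne, hne.symm] at this
  · refine ⟨xIdx i, Sum.inl (), by simp [stdWeight], fun h0 => ?_⟩
    have := hentry _ _ (xIdx i) (Sum.inl ()) h0
    simp [stdVec] at this

theorem exists_stdWeight_eq (c : ℕ → ℕ) (a : Idx n) :
    ∃ j : ℤ, stdWeight a (combH n fun k => (c k : ℝ)) = j * I := by
  have hL : ∀ i : Fin n, ∃ j : ℤ, L i (combH n fun k => (c k : ℝ)) = j * I := fun i =>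
    ⟨_, by rw [L_eq_coord, coord_combH_nat]; norm_cast⟩
  rcases a with a | i | i
  · exact ⟨0, by simp [stdWeight]⟩
  · exact hL i
  · obtain ⟨j, hj⟩ := hL i
    exact ⟨-j, by rw [stdWeight, LinearMap.neg_apply, hj, Int.cast_neg, neg_mul]⟩

/-- A root vector for the `k`-th simple root has degree `c k` for one element and `d k` for the
other, which gives the forward direction. Conversely, passing from `c` to `d` cannot raise the
degree of a positive root vector; negative root vectors and the torus have degree at most 0 for `d`,
which suffices because only `i ≥ 0` is tested. -/
theorem preceq_combH_iff (c d : ℕ → ℕ) :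
    Preceq (combH n fun k => (c k : ℝ)) (combH n fun k => (d k : ℝ)) ↔
      ∀ k ∈ Finset.Icc 1 n, d k ≤ c k := by
  constructor
  · intro h k hk
    rw [Finset.mem_Icc] at hk
    obtain ⟨a, b, hab, hne⟩ := exists_rootVec_simpleRoot (⟨k - 1, by omega⟩ : Fin n)
    have hmem : ∀ e : ℕ → ℕ,
        rootVec a b ∈ gradedPart (combH n fun k => (e k : ℝ)) ((e k : ℕ) : ℤ) := fun e => by
      refine rootVec_mem_gradedPart ?_
      rw [hab, simpleRoot_combH]
      simp [Nat.sub_add_cancel hk.1]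
    exact_mod_cast le_of_mem_filteredPart hne (hmem d)
      (h (c k : ℤ) (Int.natCast_nonneg _) (gradedPart_le_filteredPart _ le_rfl (hmem c)))
  · intro h i hi
    refine iSup₂_le fun j hj => ?_
    -- An eigenspace of `ad ξ` is spanned by the root vectors it contains, so it is enough to follow
    -- these.
    refine (eigenspace_le_span _ (fun q : Idx n × Idx n => rootVec q.1 q.2)
      (fun q => (stdWeight q.1 + stdWeight q.2) (combH n fun k => (c k : ℝ)))
      (fun q => ?_) span_rootVec _).trans ?_
    · rw [LieAlgebra.ad_apply, torus_lie_rootVec]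
    rw [Submodule.span_le]
    rintro _ ⟨⟨a, b⟩, hab, rfl⟩
    replace hab : (stdWeight a + stdWeight b) (combH n fun k => (c k : ℝ)) = (j : ℂ) * I := hab
    change rootVec a b ∈ filteredPart _ i
    by_cases hne : a = b
    · rw [hne, rootVec, wedge_self]
      exact Submodule.zero_mem _
    obtain ⟨ja, hja⟩ := exists_stdWeight_eq (n := n) d a
    obtain ⟨jb, hjb⟩ := exists_stdWeight_eq (n := n) d b
    have hd : (stdWeight a + stdWeight b) (combH n fun k => (d k : ℝ)) = ((ja + jb : ℤ) : ℂ) * I := by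
      rw [LinearMap.add_apply, hja, hjb]; push_cast; ring
    refine gradedPart_le_filteredPart _ (j := ja + jb) ?_ (rootVec_mem_gradedPart hd)
    have him : ∀ z : ℤ, ((z : ℂ) * I).im = z := fun z => by simp
    rcases stdWeight_add_cases a b hne with hα | hα | hα
    · have h1 := posRoot_combH_nonneg hα (c := fun k => (c k : ℝ) - d k)
        fun k hk => sub_nonneg.2 (Nat.cast_le.2 (h k hk))
      rw [← combH_sub, map_sub, Complex.sub_im, hab, hd, him, him, sub_nonneg] at h1
      exact (Int.cast_le.1 h1).trans hj
    · have h1 := posRoot_combH_nonneg hα (c := fun k => (d k : ℝ)) fun k _ => Nat.cast_nonneg _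
      rw [LinearMap.neg_apply, hd, Complex.neg_im, him, neg_nonneg] at h1
      exact le_trans (by exact_mod_cast h1) hi
    · rw [hα.1, LinearMap.zero_apply] at hd
      have h1 := congrArg Complex.im hd
      rw [him, Complex.zero_im] at h1
      have h2 : ja + jb = 0 := by exact_mod_cast h1.symm
      omega

theorem isCanonical_iff (S : Finset ℕ) (ξ : torus n) : IsCanonical n S ξ ↔
    ∃ c : ℕ → ℕ, ξ = (combH n fun k => (c k : ℝ)) ∧ Admissible n S c ∧
      ∀ d, Admissible n S d → (∀ k ∈ Finset.Icc 1 n, d k ≤ c k) →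
        ∀ k ∈ Finset.Icc 1 n, d k = c k := by
  constructor
  · rintro ⟨hmem, hmax⟩
    obtain ⟨c, hc, rfl⟩ := (mem_dominantLattice_inter_cone_iff S ξ).1 hmem
    refine ⟨c, rfl, hc, fun d hd hle k hk => ?_⟩
    have heq := hmax _ ((mem_dominantLattice_inter_cone_iff S _).2 ⟨d, hd, rfl⟩)
      ((preceq_combH_iff c d).2 hle)
    have h2 : Preceq (combH n fun k => (d k : ℝ)) (combH n fun k => (c k : ℝ)) := by
      rw [← heq]; exact fun i _ => le_rfl
    exact le_antisymm (hle k hk) ((preceq_combH_iff d c).1 h2 k hk)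
  · rintro ⟨c, rfl, hc, hmax⟩
    refine ⟨(mem_dominantLattice_inter_cone_iff S _).2 ⟨c, hc, rfl⟩, fun ξ' hξ' hle => ?_⟩
    obtain ⟨d, hd, rfl⟩ := (mem_dominantLattice_inter_cone_iff S ξ').1 hξ'
    exact combH_congr fun k hk => by
      rw [hmax d hd ((preceq_combH_iff c d).1 hle) k hk]

/-! ### Minimal coefficient functions for each parity -/

theorem xi_eq_combH {S : Finset ℕ} (hS : S ⊆ Finset.Icc 1 n) :
    xi n S = combH n fun k => ((if k ∈ S then 1 else 0 : ℕ) : ℝ) := by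
  rw [xi, combH, ← Finset.inter_eq_right.2 hS, ← Finset.filter_mem_eq_inter, Finset.sum_filter]
  refine Finset.sum_congr rfl fun k hk => ?_
  rw [Finset.filter_mem_eq_inter, Finset.inter_eq_right.2 hS]
  split_ifs <;> simp

theorem H_add_xi_eq_combH {S : Finset ℕ} (hS : S ⊆ Finset.Icc 1 n) {j : ℕ} (hj : j ∈ S) :
    H n j + xi n S =
      combH n fun k => (((if k ∈ S then 1 else 0) + if k = j then 1 else 0 : ℕ) : ℝ) := by
  have h : combH n (fun k => if k = j then 1 else 0) = H n j := by
    simp [combH, Finset.mem_Icc.1 (hS hj)]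
  rw [xi_eq_combH hS, ← h, combH, combH, combH, ← Finset.sum_add_distrib]
  refine Finset.sum_congr rfl fun k _ => ?_
  rw [← add_smul]
  push_cast
  rw [add_comm]

theorem sum_mul_indicator {S : Finset ℕ} (hS : S ⊆ Finset.Icc 1 n) :
    ∑ k ∈ Finset.Icc 1 n, k * (if k ∈ S then 1 else 0) = ∑ k ∈ S, k := by
  simp only [mul_ite, mul_one, mul_zero, Finset.sum_ite_mem, Finset.inter_eq_right.2 hS]

theorem sum_mul_indicator_add {S : Finset ℕ} (hS : S ⊆ Finset.Icc 1 n) {j : ℕ} (hj : j ∈ S) :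
    ∑ k ∈ Finset.Icc 1 n, k * ((if k ∈ S then 1 else 0) + if k = j then 1 else 0) =
      ∑ k ∈ S, k + j := by
  simp only [mul_add, Finset.sum_add_distrib, sum_mul_indicator hS]
  simp [Finset.mem_Icc.1 (hS hj)]

theorem Admissible.indicator_le {S : Finset ℕ} {c : ℕ → ℕ} (hc : Admissible n S c) :
    ∀ k ∈ Finset.Icc 1 n, (if k ∈ S then 1 else 0) ≤ c k := fun k hk => by
  split_ifs with h
  · exact Nat.one_le_iff_ne_zero.2 fun h0 => (hc.1 k hk).1 h0 h
  · exact Nat.zero_le _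

theorem isCanonical_iff_of_even {S : Finset ℕ} (hS : S ⊆ Finset.Icc 1 n)
    (he : Even (∑ i ∈ S, i)) (ξ : torus n) : IsCanonical n S ξ ↔ ξ = xi n S := by
  have hadm : Admissible n S fun k => if k ∈ S then 1 else 0 :=
    ⟨fun k _ => by simp, by rwa [sum_mul_indicator hS]⟩
  rw [isCanonical_iff, xi_eq_combH hS]
  constructor
  · rintro ⟨c, rfl, hc, hmin⟩
    exact combH_congr fun k hk => by rw [hmin _ hadm hc.indicator_le k hk]
  · rintro rfl
    exact ⟨_, rfl, hadm, fun d hd hle k hk => le_antisymm (hle k hk) (hd.indicator_le k hk)⟩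

theorem isCanonical_iff_of_odd {S : Finset ℕ} (hS : S ⊆ Finset.Icc 1 n)
    (ho : Odd (∑ i ∈ S, i)) (ξ : torus n) :
    IsCanonical n S ξ ↔ ∃ j ∈ S, Odd j ∧ ξ = H n j + xi n S := by
  have hadm : ∀ j ∈ S, Odd j →
      Admissible n S fun k => (if k ∈ S then 1 else 0) + if k = j then 1 else 0 :=
    fun j hj hodd => ⟨fun k _ => by
      by_cases hk : k ∈ S
      · simp [hk]
      · have : k ≠ j := fun h => hk (h ▸ hj)
        simp [hk, this], by
      rw [sum_mul_indicator_add hS hj]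
      exact ho.add_odd hodd⟩
  rw [isCanonical_iff]
  constructor
  · rintro ⟨c, rfl, hc, hmin⟩
    have hex : ∃ j ∈ S, Odd j ∧ 2 ≤ c j := by
      by_contra hno
      push Not at hno
      refine Nat.not_even_iff_odd.2 ho ?_
      -- If `c` were 1 at every odd `k ∈ S`, each `k (c k + 1_S k)` would be even. Then `∑ k c_k`
      -- and `∑ S` would have the same parity, against the evenness of the former.
      have h1 : Even (∑ k ∈ Finset.Icc 1 n, k * c k + ∑ k ∈ S, k) := by
        rw [← sum_mul_indicator hS, ← Finset.sum_add_distrib]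
        refine Finset.even_sum _ fun k hk => ?_
        rw [← mul_add]
        rcases Nat.even_or_odd k with hk2 | hk2
        · exact hk2.mul_right _
        · refine Even.mul_left ?_ _
          by_cases hkS : k ∈ S
          · have h2 := hno k hkS hk2
            have h3 := hc.indicator_le k hk
            rw [if_pos hkS] at h3 ⊢
            have : c k = 1 := by omega
            rw [this]; decide
          · rw [(hc.1 k hk).2 hkS, if_neg hkS]; decide
      exact (Nat.even_add.1 h1).1 hc.2
    obtain ⟨j, hj, hodd, h2⟩ := hex
    refine ⟨j, hj, hodd, ?_⟩
    rw [H_add_xi_eq_combH hS hj]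
    refine combH_congr fun k hk => ?_
    rw [hmin _ (hadm j hj hodd) (fun k hk => ?_) k hk]
    by_cases hkj : k = j
    · subst hkj; simp [hj, h2]
    · simpa [hkj] using hc.indicator_le k hk
  · rintro ⟨j, hj, hodd, rfl⟩
    refine ⟨_, H_add_xi_eq_combH hS hj, hadm j hj hodd, fun d hd hle => ?_⟩
    have hne : ∀ k ∈ Finset.Icc 1 n, k ≠ j → d k = if k ∈ S then 1 else 0 := fun k hk hkj =>
      le_antisymm (by simpa [hkj] using hle k hk) (hd.indicator_le k hk)
    have h2 : d j = 2 := by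
      have h3 := hle j (hS hj)
      have h4 := hd.indicator_le j (hS hj)
      simp only [if_pos hj, if_true] at h3 h4
      by_contra h5
      have h6 : d j = 1 := by omega
      -- With `d j = 1` the function `d` would be the indicator of `S`, whose weighted sum is odd.
      refine Nat.not_even_iff_odd.2 ho ?_
      rw [← sum_mul_indicator hS]
      have h7 := hd.2
      rwa [Finset.sum_congr rfl (g := fun k => k * if k ∈ S then 1 else 0) fun k hk => ?_] at h7
      by_cases hkj : k = j
      · subst hkj; simp [h6, hj]
      · simp only [hne k hk hkj]
    intro k hk
    by_cases hkj : k = j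
    · subst hkj; simp [h2, hj]
    · simp [hne k hk hkj, hkj]

/-! ### Uniqueness of the highest weight -/

/-- The element of the torus on which the simple roots take the value `√-1`. -/
def rhoCheck (n : ℕ) : torus n := ∑ i : Fin n, ((n : ℝ) - (i : ℕ)) • E i

/-- The coordinates of `rhoCheck` are `n, n - 1, …, 1`, so each positive root takes a positive
integer value, its height. This grades modules by one integer. -/
theorem posRoot_rhoCheck {α : torus n →ₗ[ℝ] ℂ} (hα : α ∈ posRoots n) :
    ∃ k : ℕ, α (rhoCheck n) = ((k + 1 : ℕ) : ℂ) * I := by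
  have hL : ∀ i : Fin n, L i (rhoCheck n) = ((n : ℂ) - (i : ℕ)) * I := fun i => by
    rw [rhoCheck, E_sum_coe]; push_cast; rfl
  rcases hα with ⟨i, j, hij, rfl | rfl⟩ | ⟨i, rfl⟩
  · have : (i : ℕ) < j := hij
    refine ⟨j - i - 1, ?_⟩
    have h : (j : ℕ) - i - 1 + 1 = j - i := by omega
    rw [LinearMap.sub_apply, hL, hL, h, Nat.cast_sub this.le]
    ring
  · refine ⟨(n - i) + (n - j) - 1, ?_⟩
    have hi := i.2
    have hj := j.2
    have h : (n - i) + (n - j) - 1 + 1 = (n - (i : ℕ)) + (n - (j : ℕ)) := by omega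
    rw [LinearMap.add_apply, hL, hL, h, Nat.cast_add, Nat.cast_sub hi.le, Nat.cast_sub hj.le]
    ring
  · refine ⟨n - i - 1, ?_⟩
    have hi := i.2
    have h : n - (i : ℕ) - 1 + 1 = n - i := by omega
    rw [hL, h, Nat.cast_sub hi.le]

section

variable {V : Type*} [AddCommGroup V] [Module ℂ V] [LieRingModule (LieGC n) V]
  [LieModule ℂ (LieGC n) V]

/-- The generators of the lower Borel subalgebra. -/
def lowerGens (n : ℕ) : Set (LieGC n) :=
  {x | (∃ ξ : torus n, x = toComplex (ξ : LieG n)) ∨ ∃ α ∈ posRoots n, x ∈ rootSpace (-α)}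

/-- A highest weight vector generates the module under the lower Borel subalgebra alone. Let `W` be
the least subspace containing `v` and stable under the lower generators, and `W'` the set of `w ∈ W`
that the whole algebra maps into `W`. From `x b w = [x, b] w + b x w` and the triangular
decomposition, `W'` is again stable and contains `v`. So `W = W'` is a Lie submodule, hence
everything. -/
theorem eq_top_of_lowerGens [LieModule.IsIrreducible ℂ (LieGC n) V] {v : V} (hv : v ≠ 0)
    (hpos : ∀ α ∈ posRoots n, ∀ x ∈ rootSpace α, ⁅x, v⁆ = 0) {N : Submodule ℂ V} (hvN : v ∈ N)
    (hN : ∀ b ∈ lowerGens n, ∀ w ∈ N, ⁅b, w⁆ ∈ N) : N = ⊤ := by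
  let W : Submodule ℂ V := sInf {N | v ∈ N ∧ ∀ b ∈ lowerGens n, ∀ w ∈ N, ⁅b, w⁆ ∈ N}
  have hvW : v ∈ W := Submodule.mem_sInf.2 fun N hN => hN.1
  have hbW : ∀ b ∈ lowerGens n, ∀ w ∈ W, ⁅b, w⁆ ∈ W := fun b hb w hw =>
    Submodule.mem_sInf.2 fun N hN => hN.2 b hb w (Submodule.mem_sInf.1 hw N hN)
  let W' : Submodule ℂ V :=
    { carrier := {w | w ∈ W ∧ ∀ x : LieGC n, ⁅x, w⁆ ∈ W}
      zero_mem' := ⟨W.zero_mem, fun x => by rw [lie_zero]; exact W.zero_mem⟩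
      add_mem' := fun ha hb => ⟨W.add_mem ha.1 hb.1, fun x => by
        rw [lie_add]; exact W.add_mem (ha.2 x) (hb.2 x)⟩
      smul_mem' := fun c w hw => ⟨W.smul_mem c hw.1, fun x => by
        rw [lie_smul]; exact W.smul_mem c (hw.2 x)⟩ }
  have hind : ∀ w ∈ W, (∀ α ∈ posRoots n, ∀ x ∈ rootSpace α, ⁅x, w⁆ ∈ W) →
      ∀ x : LieGC n, ⁅x, w⁆ ∈ W := fun w hw hp x => by
    induction x using lieGC_induction with
    | zero => rw [zero_lie]; exact W.zero_mem
    | add x y hx hy => rw [add_lie]; exact W.add_mem hx hy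
    | smul c x hx => rw [smul_lie]; exact W.smul_mem c hx
    | torus ξ => exact hbW _ (Or.inl ⟨ξ, rfl⟩) w hw
    | pos α hα x hx => exact hp α hα x hx
    | neg α hα x hx => exact hbW _ (Or.inr ⟨α, hα, hx⟩) w hw
  have hWW' : W ≤ W' := by
    refine sInf_le ⟨⟨hvW, hind v hvW fun α hα x hx => ?_⟩, fun b hb w hw => ?_⟩
    · rw [hpos α hα x hx]; exact W.zero_mem
    · refine ⟨hbW b hb w hw.1, hind _ (hbW b hb w hw.1) fun α _ x _ => ?_⟩
      rw [leibniz_lie]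
      exact W.add_mem (hw.2 _) (hbW b hb _ (hw.2 x))
  let U : LieSubmodule ℂ (LieGC n) V := { W with lie_mem := fun {x w} hw => (hWW' hw).2 x }
  have hU : U = ⊤ := (eq_bot_or_eq_top U).resolve_left fun h => hv <| by
    have : v ∈ U := hvW
    rwa [h, LieSubmodule.mem_bot] at this
  refine eq_top_iff.2 fun w _ => ?_
  have hw : w ∈ U := by rw [hU]; trivial
  exact Submodule.mem_sInf.1 (show w ∈ W from hw) N ⟨hvN, hN⟩

variable (V) in
/-- The action of `rhoCheck`. -/
def rhoEnd : Module.End ℂ V := LieModule.toEnd ℂ (LieGC n) V (toComplex (rhoCheck n : LieG n))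

theorem lie_mem_eigenspace {α : torus n →ₗ[ℝ] ℂ} {x : LieGC n} (hx : x ∈ rootSpace α) {w : V}
    {μ : ℂ} (hw : w ∈ (rhoEnd (n := n) V).eigenspace μ) :
    ⁅x, w⁆ ∈ (rhoEnd (n := n) V).eigenspace (μ + α (rhoCheck n)) := by
  rw [Module.End.mem_eigenspace_iff] at hw ⊢
  have h : ⁅toComplex (rhoCheck n : LieG n), w⁆ = μ • w := hw
  change ⁅toComplex (rhoCheck n : LieG n), ⁅x, w⁆⁆ = _
  rw [leibniz_lie, hx, h, smul_lie, lie_smul, ← add_smul, add_comm]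

/-- The lower generators keep or lower the `rhoCheck`-eigenvalue, so apart from the line of `v` only
strictly lower eigenvalues occur. -/
theorem span_sup_eigenspaces [LieModule.IsIrreducible ℂ (LieGC n) V] {ω : torus n →ₗ[ℝ] ℂ} {v : V}
    (hv : v ≠ 0) (hω : ∀ X : torus n, ⁅toComplex (X : LieG n), v⁆ = ω X • v)
    (hpos : ∀ α ∈ posRoots n, ∀ x ∈ rootSpace α, ⁅x, v⁆ = 0) :
    Submodule.span ℂ {v} ⊔ ⨆ k : ℕ,
      (rhoEnd (n := n) V).eigenspace (ω (rhoCheck n) - ((k + 1 : ℕ) : ℂ) * I) = ⊤ := by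
  have hvmem : v ∈ (rhoEnd (n := n) V).eigenspace (ω (rhoCheck n)) :=
    Module.End.mem_eigenspace_iff.2 (hω _)
  set M : Submodule ℂ V := ⨆ k : ℕ,
    (rhoEnd (n := n) V).eigenspace (ω (rhoCheck n) - ((k + 1 : ℕ) : ℂ) * I) with hM
  refine eq_top_of_lowerGens hv hpos
    (Submodule.mem_sup_left (Submodule.mem_span_singleton_self v)) fun b hb => ?_
  suffices h : Submodule.span ℂ {v} ⊔ M ≤ Submodule.comap (LieModule.toEnd ℂ (LieGC n) V b)
      (Submodule.span ℂ {v} ⊔ M) from fun w hw => h hw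
  rw [sup_le_iff, Submodule.span_singleton_le_iff_mem]
  nth_rewrite 2 [hM]
  rw [iSup_le_iff]
  rcases hb with ⟨ξ, rfl⟩ | ⟨α, hα, hb⟩
  · refine ⟨?_, fun k w hw => Submodule.mem_sup_right (Submodule.mem_iSup_of_mem k ?_)⟩
    · rw [Submodule.mem_comap, LieModule.toEnd_apply_apply, hω]
      exact Submodule.mem_sup_left (Submodule.smul_mem _ _ (Submodule.mem_span_singleton_self v))
    · have h0 : (toComplex (ξ : LieG n) : LieGC n) ∈ rootSpace 0 := fun X => by
        rw [toComplex_torus_lie]; simp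
      simpa using lie_mem_eigenspace h0 hw
  · obtain ⟨m, hm⟩ := posRoot_rhoCheck hα
    refine ⟨Submodule.mem_sup_right (Submodule.mem_iSup_of_mem m ?_),
      fun k w hw => Submodule.mem_sup_right (Submodule.mem_iSup_of_mem (k + m + 1) ?_)⟩
    · have := lie_mem_eigenspace hb hvmem
      rwa [LinearMap.neg_apply, hm, ← sub_eq_add_neg] at this
    · have := lie_mem_eigenspace hb hw
      rw [LinearMap.neg_apply, hm] at this
      have heq : ω (rhoCheck n) - ((k + m + 1 + 1 : ℕ) : ℂ) * I =
          ω (rhoCheck n) - ((k + 1 : ℕ) : ℂ) * I + -(((m + 1 : ℕ) : ℂ) * I) := by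
        push_cast
        ring
      rw [heq]
      exact this

/-- The eigenvalue of `v'` must be one of those in the decomposition generated by `v`. If it is the
top one, independence of eigenspaces puts `v'` on the line of `v`. Applying this in both directions
gives uniqueness. -/
theorem exists_nat_of_highest [LieModule.IsIrreducible ℂ (LieGC n) V] {ω ω' : torus n →ₗ[ℝ] ℂ}
    (h : IsHighestWeight n V ω) (h' : IsHighestWeight n V ω') :
    ∃ k : ℕ, ω' (rhoCheck n) = ω (rhoCheck n) - k * I ∧ (k = 0 → ω' = ω) := by
  obtain ⟨v, hv, hω, hpos⟩ := h
  obtain ⟨v', hv', hω', -⟩ := h'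
  have htop := span_sup_eigenspaces hv hω hpos
  have hvmem : v ∈ (rhoEnd (n := n) V).eigenspace (ω (rhoCheck n)) :=
    Module.End.mem_eigenspace_iff.2 (hω _)
  have hvmem' : v' ∈ (rhoEnd (n := n) V).eigenspace (ω' (rhoCheck n)) :=
    Module.End.mem_eigenspace_iff.2 (hω' _)
  have hind := (rhoEnd (n := n) V).eigenspaces_iSupIndep
  by_cases hex : ∃ k : ℕ, ω' (rhoCheck n) = ω (rhoCheck n) - k * I
  · obtain ⟨k, hk⟩ := hex
    refine ⟨k, hk, fun hk0 => ?_⟩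
    subst hk0
    rw [Nat.cast_zero, zero_mul, sub_zero] at hk
    rw [hk] at hvmem'
    have hmem : v' ∈ Submodule.span ℂ {v} ⊔ ⨆ k : ℕ,
        (rhoEnd (n := n) V).eigenspace (ω (rhoCheck n) - ((k + 1 : ℕ) : ℂ) * I) := by
      rw [htop]; trivial
    obtain ⟨y, hy, z, hz, hyz⟩ := Submodule.mem_sup.1 hmem
    obtain ⟨a, rfl⟩ := Submodule.mem_span_singleton.1 hy
    have hz1 : z ∈ (rhoEnd (n := n) V).eigenspace (ω (rhoCheck n)) := by
      have := Submodule.sub_mem _ hvmem' (Submodule.smul_mem _ a hvmem)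
      rwa [← hyz, add_sub_cancel_left] at this
    have hz2 : z = 0 := by
      refine Submodule.disjoint_def.1 (hind (ω (rhoCheck n))) z hz1 ?_
      refine (iSup_le fun k => ?_ : (⨆ k : ℕ, (rhoEnd (n := n) V).eigenspace
        (ω (rhoCheck n) - ((k + 1 : ℕ) : ℂ) * I)) ≤ _) hz
      refine le_iSup₂_of_le _ (fun h => ?_) le_rfl
      rw [sub_eq_self] at h
      exact (mul_ne_zero (Nat.cast_ne_zero.2 k.succ_ne_zero) I_ne_zero) h
    rw [hz2, add_zero] at hyz
    ext X
    have h1 := hω' X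
    rw [← hyz, lie_smul, hω, smul_comm, hyz] at h1
    exact (smul_left_injective ℂ hv' h1).symm
  · exfalso
    push Not at hex
    suffices hle : (⊤ : Submodule ℂ V) ≤ ⨆ ν, ⨆ (_ : ν ≠ ω' (rhoCheck n)),
        (rhoEnd (n := n) V).eigenspace ν from
      hv' (Submodule.disjoint_def.1 (hind (ω' (rhoCheck n))) v' hvmem' (hle trivial))
    rw [← htop]
    refine sup_le ?_ (iSup_le fun k => ?_)
    · rw [Submodule.span_singleton_le_iff_mem]
      exact Submodule.mem_iSup_of_mem _ (Submodule.mem_iSup_of_mem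
        (fun h => hex 0 (by simp [h])) hvmem)
    · exact le_iSup₂_of_le _ (fun h => hex (k + 1) h.symm) le_rfl

theorem IsHighestWeight.unique [LieModule.IsIrreducible ℂ (LieGC n) V] {ω ω' : torus n →ₗ[ℝ] ℂ}
    (h : IsHighestWeight n V ω) (h' : IsHighestWeight n V ω') : ω' = ω := by
  obtain ⟨k, hk, hk0⟩ := exists_nat_of_highest h h'
  obtain ⟨k', hk', -⟩ := exists_nat_of_highest h' h
  refine hk0 ?_
  have h1 : ((k + k' : ℕ) : ℂ) * I = 0 := by
    push_cast
    linear_combination hk + hk'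
  have h2 := (mul_eq_zero.1 h1).resolve_right I_ne_zero
  have h3 : k + k' = 0 := by exact_mod_cast h2
  omega

end

/-! ### The lowest weight -/

/-- Since `R³ = -R`, `exp(tR) = 1 + sin t R + (1 - cos t) R²`, which is `1 + 2R²` at `t = π`. The
curve `Y(t) = exp(tR) x exp(-tR)` solves `Y' = [R, Y]`, so `exp(-tρ(R)) ρ(Y(t)) exp(tρ(R))` is
constant. The map `ρ` has to respect brackets with `R` only along this curve, which matters because
it will be extended from skew matrices to all matrices. -/
theorem exp_pi_mul_map {𝔸 𝔹 : Type*} [NormedRing 𝔸] [NormedAlgebra ℂ 𝔸] [NormedRing 𝔹]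
    [NormedAlgebra ℂ 𝔹] [CompleteSpace 𝔹] (ρ : 𝔸 →L[ℂ] 𝔹) (R x : 𝔸) (hR : R * R * R = -R)
    (hρ : ∀ s c : ℂ, ∀ y, y = (1 + s • R + c • (R * R)) * x * (1 - s • R + c • (R * R)) →
      ρ (R * y - y * R) = ρ R * ρ y - ρ y * ρ R) :
    NormedSpace.exp ((Real.pi : ℂ) • ρ R) * ρ x =
      ρ ((1 + (2 : ℂ) • (R * R)) * x * (1 + (2 : ℂ) • (R * R))) *
        NormedSpace.exp ((Real.pi : ℂ) • ρ R) := by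
  let P : ℂ → 𝔸 := fun t => 1 + sin t • R + (1 - cos t) • (R * R)
  let Q : ℂ → 𝔸 := fun t => 1 - sin t • R + (1 - cos t) • (R * R)
  have hP : ∀ t, HasDerivAt P (R * P t) t := fun t => by
    have h1 := ((hasDerivAt_const t (1 : 𝔸)).add ((hasDerivAt_sin t).smul_const R)).add
      (((hasDerivAt_const t (1 : ℂ)).sub (hasDerivAt_cos t)).smul_const (R * R))
    refine h1.congr_deriv ?_
    simp only [P, mul_add, mul_one, mul_smul_comm, ← mul_assoc, hR]
    module
  have hQ : ∀ t, HasDerivAt Q (-(Q t * R)) t := fun t => by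
    have h1 := ((hasDerivAt_const t (1 : 𝔸)).sub ((hasDerivAt_sin t).smul_const R)).add
      (((hasDerivAt_const t (1 : ℂ)).sub (hasDerivAt_cos t)).smul_const (R * R))
    refine h1.congr_deriv ?_
    simp only [Q, add_mul, sub_mul, one_mul, smul_mul_assoc, hR]
    module
  let Y : ℂ → 𝔸 := fun t => P t * x * Q t
  have hY : ∀ t, HasDerivAt Y (R * Y t - Y t * R) t := fun t => by
    refine (((hP t).mul_const x).mul (hQ t)).congr_deriv ?_
    simp only [Y, mul_assoc, mul_neg, sub_eq_add_neg]
  have hρY : ∀ t, HasDerivAt (fun t => ρ (Y t)) (ρ R * ρ (Y t) - ρ (Y t) * ρ R) t := fun t => by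
    rw [← hρ (sin t) (1 - cos t) (Y t) rfl]
    exact ρ.hasFDerivAt.comp_hasDerivAt t (hY t)
  let F : ℂ → 𝔹 := fun t => NormedSpace.exp (t • (-ρ R))
  let G : ℂ → 𝔹 := fun t => NormedSpace.exp (t • ρ R)
  have hF : ∀ t, HasDerivAt F (F t * -ρ R) t := fun t => hasDerivAt_exp_smul_const _ t
  have hG : ∀ t, HasDerivAt G (ρ R * G t) t := fun t => hasDerivAt_exp_smul_const' _ t
  have hg : ∀ t, HasDerivAt (fun t => F t * ρ (Y t) * G t) 0 t := fun t => by
    refine (((hF t).mul (hρY t)).mul (hG t)).congr_deriv ?_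
    rw [Pi.mul_apply]
    noncomm_ring
  have hGF : ∀ t, HasDerivAt (fun t => G t * F t) 0 t := fun t => by
    refine ((hasDerivAt_exp_smul_const (𝕂 := ℂ) (ρ R) t).mul
      (hasDerivAt_exp_smul_const' (𝕂 := ℂ) (-ρ R) t)).congr_deriv ?_
    noncomm_ring
  have hconst : ∀ f : ℂ → 𝔹, (∀ t, HasDerivAt f 0 t) → f Real.pi = f 0 := fun f hf =>
    is_const_of_deriv_eq_zero (fun t => (hf t).differentiableAt) (fun t => (hf t).deriv) _ _
  have h1 := hconst _ hg
  have h2 := hconst _ hGF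
  have hF0 : F 0 = 1 := by simp [F]
  have hG0 : G 0 = 1 := by simp [G]
  have hY0 : Y 0 = x := by simp [Y, P, Q]
  have hYpi : Y Real.pi = (1 + (2 : ℂ) • (R * R)) * x * (1 + (2 : ℂ) • (R * R)) := by
    have : (1 : ℂ) - -1 = 2 := by norm_num
    simp [Y, P, Q, this]
  simp only [hF0, hG0, hY0, hYpi, one_mul, mul_one] at h1 h2
  change G Real.pi * ρ x = _ * G Real.pi
  rw [← h1, ← mul_assoc, ← mul_assoc, h2, one_mul]

open scoped Matrix.Norms.Operator in
theorem exp_pi_mul_matrix {κ d : Type*} [Fintype κ] [DecidableEq κ] [Fintype d] [DecidableEq d]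
    (ρ : Matrix κ κ ℂ →ₗ[ℂ] Matrix d d ℂ) (R x : Matrix κ κ ℂ) (hR : R * R * R = -R)
    (hρ : ∀ s c : ℂ, ∀ y, y = (1 + s • R + c • (R * R)) * x * (1 - s • R + c • (R * R)) →
      ρ (R * y - y * R) = ρ R * ρ y - ρ y * ρ R) :
    NormedSpace.exp ((Real.pi : ℂ) • ρ R) * ρ x =
      ρ ((1 + (2 : ℂ) • (R * R)) * x * (1 + (2 : ℂ) • (R * R))) *
        NormedSpace.exp ((Real.pi : ℂ) • ρ R) :=
  exp_pi_mul_map (LinearMap.toContinuousLinearMap ρ) R x hR hρ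

/-- The skew-symmetric part of a matrix. -/
def skewPart (n : ℕ) : Matrix (Idx n) (Idx n) ℂ →ₗ[ℂ] LieGC n where
  toFun M := ⟨(1 / 2 : ℂ) • (M - M.transpose), by
    rw [LieAlgebra.Orthogonal.mem_so, Matrix.transpose_smul, Matrix.transpose_sub,
      Matrix.transpose_transpose]
    module⟩
  map_add' M N := Subtype.ext (by
    simp only [coe_add, Matrix.transpose_add]
    module)
  map_smul' c M := Subtype.ext (by
    simp only [coe_smul, Matrix.transpose_smul, RingHom.id_apply]
    module)

theorem skewPart_of_skew {M : Matrix (Idx n) (Idx n) ℂ} (hM : M.transpose = -M) :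
    (skewPart n M : Matrix (Idx n) (Idx n) ℂ) = M := by
  change (1 / 2 : ℂ) • (M - M.transpose) = M
  rw [hM]
  module

theorem transpose_coe (x : LieGC n) : (x : Matrix (Idx n) (Idx n) ℂ).transpose = -x :=
  (LieAlgebra.Orthogonal.mem_so (Idx n) ℂ _).1 x.2

section

variable (V : Type*) [AddCommGroup V] [Module ℂ V] [LieRingModule (LieGC n) V]

/-- The conjugation by the diagonal matrix with entries `d` is implemented on `V`. -/
def Implements (d : Idx n → ℂ) : Prop :=
  ∃ w : V ≃ₗ[ℂ] V, ∀ x y : LieGC n,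
    (∀ r s, (y : Matrix (Idx n) (Idx n) ℂ) r s = d r * (x : Matrix (Idx n) (Idx n) ℂ) r s * d s) →
    ∀ v : V, w ⁅x, v⁆ = ⁅y, w v⁆

theorem implements_one : Implements V (1 : Idx n → ℂ) :=
  ⟨LinearEquiv.refl ℂ V, fun x y h v => by
    have : y = x := Subtype.ext (by ext r s; simp [h])
    rw [this]; rfl⟩

variable {V} in
theorem Implements.mul {d e : Idx n → ℂ} (hd : Implements V d) (he : Implements V e) :
    Implements V (d * e) := by
  obtain ⟨w, hw⟩ := hd
  obtain ⟨u, hu⟩ := he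
  refine ⟨u.trans w, fun x y h v => ?_⟩
  let z : LieGC n := ⟨Matrix.of fun r s => e r * (x : Matrix (Idx n) (Idx n) ℂ) r s * e s, by
    rw [LieAlgebra.Orthogonal.mem_so]
    ext r s
    have := congrFun (congrFun (transpose_coe x) r) s
    simp only [Matrix.transpose_apply, Matrix.neg_apply, Matrix.of_apply] at this ⊢
    rw [this]; ring⟩
  have hz : ∀ r s, (z : Matrix (Idx n) (Idx n) ℂ) r s =
    e r * (x : Matrix (Idx n) (Idx n) ℂ) r s * e s := fun r s => rfl
  rw [LinearEquiv.trans_apply, LinearEquiv.trans_apply, hu x z hz, hw z y]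
  intro r s
  rw [h, hz]
  simp only [Pi.mul_apply]
  ring

variable [LieModule ℂ (LieGC n) V]

/-- Changing the signs of two coordinates is the rotation by `π` in their plane, so it is
implemented by the exponential of `π` times the action of its generator. -/
theorem implements_flip [FiniteDimensional ℂ V] {a b : Idx n} (hab : a ≠ b) :
    Implements V (fun r => if r = a ∨ r = b then -1 else 1) := by
  let bas := Module.finBasis ℂ V
  let Φ : Module.End ℂ V ≃ₐ[ℂ] _ := LinearMap.toMatrixAlgEquiv bas
  let τ := LieModule.toEnd ℂ (LieGC n) V
  let ρ : Matrix (Idx n) (Idx n) ℂ →ₗ[ℂ] Matrix _ _ ℂ :=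
    Φ.toLinearMap ∘ₗ (τ : LieGC n →ₗ[ℂ] Module.End ℂ V) ∘ₗ skewPart n
  let r : LieGC n := wedge (Pi.single a 1) (Pi.single b 1)
  let R : Matrix (Idx n) (Idx n) ℂ := Matrix.single a b 1 - Matrix.single b a 1
  have hr : (r : Matrix (Idx n) (Idx n) ℂ) = R := by
    simp only [r, R, coe_wedge, ← Matrix.single_eq_single_vecMulVec_single]
  have hRt : R.transpose = -R := by rw [← hr, transpose_coe]
  have hRR : R * R = -(Matrix.single a a 1 + Matrix.single b b 1) := by
    simp only [R, mul_sub, sub_mul, Matrix.single_mul_single_same, mul_one,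
      Matrix.single_mul_single_of_ne _ _ _ _ hab, Matrix.single_mul_single_of_ne _ _ _ _ hab.symm]
    abel
  have hRRR : R * R * R = -R := by
    rw [hRR]
    simp only [R, neg_mul, add_mul, mul_sub, Matrix.single_mul_single_same, mul_one,
      Matrix.single_mul_single_of_ne _ _ _ _ hab, Matrix.single_mul_single_of_ne _ _ _ _ hab.symm]
    abel
  have hD : (1 + (2 : ℂ) • (R * R) : Matrix (Idx n) (Idx n) ℂ) =
      Matrix.diagonal fun r => if r = a ∨ r = b then -1 else 1 := by
    rw [hRR]
    ext i j
    by_cases hij : i = j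
    · subst hij
      by_cases h1 : i = a
      · subst h1; simp [hab.symm]; norm_num
      · by_cases h2 : i = b
        · subst h2; simp [hab]; norm_num
        · simp [h1, h2, Ne.symm h1, Ne.symm h2]
    · have h1 : ∀ c, ¬(c = i ∧ c = j) := fun c hc => hij (hc.1.symm.trans hc.2)
      simp [hij, h1]
  have hρ : ∀ y : LieGC n, ρ y = Φ (τ y) := fun y => by
    have : skewPart n (y : Matrix (Idx n) (Idx n) ℂ) = y :=
      Subtype.ext (skewPart_of_skew (transpose_coe y))
    change Φ (τ (skewPart n (y : Matrix (Idx n) (Idx n) ℂ))) = _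
    rw [this]
  let e := NormedSpace.exp ((Real.pi : ℂ) • ρ R)
  have key : ∀ x y : LieGC n, (∀ r s, (y : Matrix (Idx n) (Idx n) ℂ) r s =
      (if r = a ∨ r = b then -1 else 1) * (x : Matrix (Idx n) (Idx n) ℂ) r s *
        (if s = a ∨ s = b then -1 else 1)) → e * Φ (τ x) = Φ (τ y) * e := by
    intro x y hxy
    have h1 := exp_pi_mul_matrix ρ R x hRRR fun s c z hz => ?_
    · have h2 : (1 + (2 : ℂ) • (R * R)) * (x : Matrix (Idx n) (Idx n) ℂ) *
          (1 + (2 : ℂ) • (R * R)) = y := by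
        rw [hD]
        ext i j
        rw [Matrix.mul_diagonal, Matrix.diagonal_mul, hxy]
      rw [h2, hρ, hρ] at h1
      exact h1
    · have hzt : z.transpose = -z := by
        rw [hz]
        simp only [Matrix.transpose_mul, Matrix.transpose_add, Matrix.transpose_sub,
          Matrix.transpose_smul, Matrix.transpose_one, hRt, transpose_coe, smul_neg, sub_neg_eq_add,
          ← sub_eq_add_neg, neg_mul, mul_neg, mul_assoc]
      obtain ⟨z', rfl⟩ : ∃ z' : LieGC n, (z' : Matrix (Idx n) (Idx n) ℂ) = z :=
        ⟨skewPart n z, skewPart_of_skew hzt⟩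
      have hτ : τ ⁅r, z'⁆ = τ r * τ z' - τ z' * τ r := LinearMap.ext fun v => lie_lie r z' v
      rw [← hr, ← coe_lie, hρ, hρ, hρ, hτ, map_sub, map_mul, map_mul]
  have hunit : IsUnit e := by
    open scoped Matrix.Norms.Operator in
    exact NormedSpace.isUnit_exp _
  obtain ⟨u, hu⟩ := (hunit.map Φ.symm)
  have hue : Φ (u : Module.End ℂ V) = e := by rw [hu, AlgEquiv.apply_symm_apply]
  refine ⟨LinearMap.GeneralLinearGroup.generalLinearEquiv ℂ V u, fun x y hxy v => ?_⟩
  have h3 := key x y hxy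
  rw [← hue, ← map_mul, ← map_mul] at h3
  exact LinearMap.congr_fun (Φ.injective h3) v

/-- Each `y_i` is flipped together with the spare coordinate `z`. The resulting sign at `z`, namely
`(-1)^n`, is irrelevant; having this coordinate is what puts `-1` in the Weyl group for every `n`.
-/
theorem exists_implements_neg [FiniteDimensional ℂ V] : ∃ d : Idx n → ℂ, Implements V d ∧
    (∀ r, d r * d r = 1) ∧ (∀ i, d (xIdx i) = 1) ∧ ∀ i, d (yIdx i) = -1 := by
  let f : Fin n → Idx n → ℂ := fun i r => if r = Sum.inl () ∨ r = yIdx i then -1 else 1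
  refine ⟨∏ i, f i, Finset.prod_induction f (Implements V) (fun _ _ => Implements.mul)
    (implements_one V) (fun i _ => implements_flip V (by simp)), fun r => ?_, fun i => ?_,
    fun i => ?_⟩
  · rw [← Pi.mul_apply, ← Finset.prod_mul_distrib, Finset.prod_apply]
    refine Finset.prod_eq_one fun i _ => ?_
    simp only [f, Pi.mul_apply]
    split_ifs <;> norm_num
  · rw [Finset.prod_apply]
    exact Finset.prod_eq_one fun j _ => by simp [f]
  · rw [Finset.prod_apply, Finset.prod_eq_single i]
    · simp [f]
    · intro j _ hj
      simp [f, Ne.symm hj]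
    · simp

/-- Conjugation by a diagonal matrix. -/
def diagConj (d : Idx n → ℂ) (x : LieGC n) : LieGC n :=
  ⟨Matrix.diagonal d * (x : Matrix (Idx n) (Idx n) ℂ) * Matrix.diagonal d, by
    rw [LieAlgebra.Orthogonal.mem_so]
    simp only [Matrix.transpose_mul, Matrix.diagonal_transpose, transpose_coe, neg_mul, mul_neg,
      mul_assoc]⟩

theorem diagConj_apply (d : Idx n → ℂ) (x : LieGC n) (r s : Idx n) :
    (diagConj d x : Matrix (Idx n) (Idx n) ℂ) r s =
      d r * (x : Matrix (Idx n) (Idx n) ℂ) r s * d s := by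
  change (Matrix.diagonal d * (x : Matrix (Idx n) (Idx n) ℂ) * Matrix.diagonal d) r s = _
  rw [Matrix.mul_diagonal, Matrix.diagonal_mul]

theorem diagConj_lie {d : Idx n → ℂ} (hd : ∀ r, d r * d r = 1) (x y : LieGC n) :
    ⁅diagConj d x, diagConj d y⁆ = diagConj d ⁅x, y⁆ := by
  have hdd : ∀ M : Matrix (Idx n) (Idx n) ℂ, Matrix.diagonal d * (Matrix.diagonal d * M) = M :=
    fun M => by rw [← mul_assoc, Matrix.diagonal_mul_diagonal]; simp [hd]
  apply Subtype.ext
  rw [coe_lie]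
  simp only [diagConj, coe_lie, mul_sub, sub_mul, mul_assoc, hdd]

theorem diagConj_diagConj {d : Idx n → ℂ} (hd : ∀ r, d r * d r = 1) (x : LieGC n) :
    diagConj d (diagConj d x) = x := by
  apply Subtype.ext
  ext r s
  rw [diagConj_apply, diagConj_apply]
  linear_combination (d s * d s) * (x : Matrix (Idx n) (Idx n) ℂ) r s * hd r +
    (x : Matrix (Idx n) (Idx n) ℂ) r s * hd s

theorem diagConj_smul (d : Idx n → ℂ) (c : ℂ) (x : LieGC n) :
    diagConj d (c • x) = c • diagConj d x := by
  apply Subtype.ext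
  ext r s
  rw [diagConj_apply, coe_smul, coe_smul, Matrix.smul_apply, Matrix.smul_apply, diagConj_apply]
  simp only [smul_eq_mul]
  ring

theorem diagConj_torus {d : Idx n → ℂ} (hx : ∀ i, d (xIdx i) = 1) (hy : ∀ i, d (yIdx i) = -1)
    (ξ : torus n) : diagConj d (toComplex (ξ : LieG n)) = -toComplex (ξ : LieG n) := by
  have hrot : ∀ i, diagConj d (toComplex (rot i)) = -toComplex (rot i) := fun i => by
    apply Subtype.ext
    ext r s
    change _ = -(toComplex (rot i) : Matrix (Idx n) (Idx n) ℂ) r s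
    rw [diagConj_apply, coe_toComplex_rot, Matrix.sub_apply, Matrix.single_apply,
      Matrix.single_apply]
    by_cases h1 : yIdx i = r ∧ xIdx i = s
    · obtain ⟨rfl, rfl⟩ := h1
      simp [hx, hy]
    · by_cases h2 : xIdx i = r ∧ yIdx i = s
      · obtain ⟨rfl, rfl⟩ := h2
        simp [hx, hy]
      · simp [h1, h2]
  rw [toComplex_torus]
  apply Subtype.ext
  ext r s
  rw [diagConj_apply]
  have hneg : ∀ y : LieGC n, ((-y : LieGC n) : Matrix (Idx n) (Idx n) ℂ) = -y := fun _ => rfl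
  have hsm : ∀ (c : ℝ) (y : LieGC n), ((c • y : LieGC n) : Matrix (Idx n) (Idx n) ℂ) = c • y :=
    fun _ _ => rfl
  simp only [hneg, coe_sum, hsm, Matrix.sum_apply, Matrix.neg_apply, Matrix.smul_apply,
    Finset.mul_sum, Finset.sum_mul, ← Finset.sum_neg_distrib]
  refine Finset.sum_congr rfl fun i _ => ?_
  have := congrFun (congrFun (congrArg Subtype.val (hrot i)) r) s
  rw [diagConj_apply] at this
  rw [mul_smul_comm, smul_mul_assoc, this, hneg, Matrix.neg_apply, smul_neg]

theorem diagConj_mem_rootSpace {d : Idx n → ℂ} (hd : ∀ r, d r * d r = 1)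
    (hx : ∀ i, d (xIdx i) = 1) (hy : ∀ i, d (yIdx i) = -1) {α : torus n →ₗ[ℝ] ℂ} {x : LieGC n}
    (h : x ∈ rootSpace α) : diagConj d x ∈ rootSpace (-α) := fun X => by
  have h1 := diagConj_lie hd (toComplex (X : LieG n)) x
  rw [diagConj_torus hx hy, h X, diagConj_smul, neg_lie] at h1
  rw [LinearMap.neg_apply, neg_smul, ← h1, neg_neg]

variable {V} in
-- The implementing operator `w` negates weights and, since the conjugation takes `𝔤_α` to `𝔤_{-α}`,
-- exchanges the two annihilation conditions.
theorem isLowestWeight_neg_iff [FiniteDimensional ℂ V] (ω : torus n →ₗ[ℝ] ℂ) :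
    IsLowestWeight n V (-ω) ↔ IsHighestWeight n V ω := by
  obtain ⟨d, ⟨w, hw⟩, hd, hx, hy⟩ := exists_implements_neg (n := n) V
  have hw' : ∀ (x : LieGC n) (v : V), w ⁅x, v⁆ = ⁅diagConj d x, w v⁆ := fun x v =>
    hw x _ (diagConj_apply d x) v
  have hwd : ∀ (x : LieGC n) (v : V), ⁅x, w v⁆ = w ⁅diagConj d x, v⁆ := fun x v => by
    rw [hw', diagConj_diagConj hd]
  have hwt : ∀ (X : torus n) (v : V), ⁅toComplex (X : LieG n), w v⁆ =
      -w ⁅toComplex (X : LieG n), v⁆ := fun X v => by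
    rw [hwd, diagConj_torus hx hy, neg_lie, map_neg]
  constructor
  · rintro ⟨v, hv, hω, hα⟩
    refine ⟨w v, fun h => hv (by simpa using h), fun X => ?_, fun α hα' x hx' => ?_⟩
    · rw [hwt, hω, map_smul, LinearMap.neg_apply, neg_smul, neg_neg]
    · rw [hwd, hα α hα' _ (diagConj_mem_rootSpace hd hx hy hx'), map_zero]
  · rintro ⟨v, hv, hω, hα⟩
    refine ⟨w v, fun h => hv (by simpa using h), fun X => ?_, fun α hα' x hx' => ?_⟩
    · rw [hwt, hω, map_smul, LinearMap.neg_apply, neg_smul]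
    · rw [hwd, hα α hα' _ ?_, map_zero]
      have := diagConj_mem_rootSpace hd hx hy hx'
      rwa [neg_neg] at this

theorem highestWeight_eq [LieModule.IsIrreducible ℂ (LieGC n) V] {ω : torus n →ₗ[ℝ] ℂ}
    (h : IsHighestWeight n V ω) : highestWeight n V = ω :=
  h.unique (Classical.epsilon_spec (p := IsHighestWeight n V) ⟨ω, h⟩)

theorem lowestWeight_eq [FiniteDimensional ℂ V] [LieModule.IsIrreducible ℂ (LieGC n) V]
    {ω : torus n →ₗ[ℝ] ℂ} (h : IsHighestWeight n V ω) : lowestWeight n V = -ω := by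
  have h1 : IsLowestWeight n V (lowestWeight n V) :=
    Classical.epsilon_spec (p := IsLowestWeight n V) ⟨-ω, (isLowestWeight_neg_iff ω).2 h⟩
  rw [← neg_neg (lowestWeight n V), isLowestWeight_neg_iff] at h1
  rw [← h.unique h1, neg_neg]

theorem unitonNumber_eq [FiniteDimensional ℂ V] [LieModule.IsIrreducible ℂ (LieGC n) V]
    {ω : torus n →ₗ[ℝ] ℂ} (h : IsHighestWeight n V ω) (ξ : torus n) :
    unitonNumber n V ξ = 2 * ω ξ / I := by
  rw [unitonNumber, highestWeight_eq V h, lowestWeight_eq V h, LinearMap.neg_apply]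
  ring

end

/-! ### Values of the fundamental weights on `H_j` and `ξ_I` -/

theorem L_xi (S : Finset ℕ) (i : Fin n) :
    L i (xi n S) = ((S.filter fun k => (i : ℕ) + 1 ≤ k).card : ℂ) * I := by
  simp [xi, L_H, Finset.sum_ite]

theorem sum_filter_fin {M : Type*} [AddCommMonoid M] {k : ℕ} (hk : k ≤ n) (g : ℕ → M) :
    ∑ j ∈ Finset.univ.filter (fun j : Fin n => (j : ℕ) + 1 ≤ k), g ((j : ℕ) + 1) =
      ∑ m ∈ Finset.Icc 1 k, g m := by
  rw [Finset.sum_filter, Fin.sum_univ_eq_sum_range (fun j => if j + 1 ≤ k then g (j + 1) else 0),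
    ← Finset.sum_filter]
  refine Finset.sum_bij' (fun j _ => j + 1) (fun m _ => m - 1) ?_ ?_ ?_ ?_ fun _ _ => rfl <;>
    simp only [Finset.mem_filter, Finset.mem_range, Finset.mem_Icc] <;> intros <;> omega

theorem card_filter_le_eq {S : Finset ℕ} (hS : S ⊆ Finset.Icc 1 n) (m : ℕ) :
    (S.filter fun k => m ≤ k).card = (S ∩ Finset.Icc m n).card := by
  congr 1
  ext k
  simp only [Finset.mem_filter, Finset.mem_inter, Finset.mem_Icc]
  exact ⟨fun h => ⟨h.1, h.2, (Finset.mem_Icc.1 (hS h.1)).2⟩, fun h => ⟨h.1, h.2.1⟩⟩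

theorem sum_L_xi {S : Finset ℕ} (hS : S ⊆ Finset.Icc 1 n) {k : ℕ} (hk : k ≤ n) :
    (∑ j ∈ Finset.univ.filter (fun j : Fin n => (j : ℕ) + 1 ≤ k), L j) (xi n S) =
      (∑ m ∈ Finset.Icc 1 k, ((S ∩ Finset.Icc m n).card : ℂ)) * I := by
  simp only [LinearMap.sum_apply, L_xi, card_filter_le_eq hS, ← Finset.sum_mul]
  rw [sum_filter_fin hk fun m => ((S ∩ Finset.Icc m n).card : ℂ)]

theorem sum_L_H (j : ℕ) {k : ℕ} (hk : k ≤ n) :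
    (∑ j ∈ Finset.univ.filter (fun j : Fin n => (j : ℕ) + 1 ≤ k), L j) (H n j) =
      ((min j k : ℕ) : ℂ) * I := by
  simp only [LinearMap.sum_apply, L_H]
  rw [sum_filter_fin hk fun m => if m ≤ j then I else 0, ← Finset.sum_filter]
  have : (Finset.Icc 1 k).filter (fun m => m ≤ j) = Finset.Icc 1 (min j k) := by
    ext m; simp only [Finset.mem_filter, Finset.mem_Icc]; omega
  rw [this]
  simp

/-- Writing the spin weight as half of the pattern for `k < n` lets the same two sums serve both
cases. -/
theorem fundWeight_top : fundWeight n n =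
    (1 / 2 : ℝ) • ∑ j ∈ Finset.univ.filter (fun j : Fin n => (j : ℕ) + 1 ≤ n), L j := by
  rw [fundWeight, if_neg (lt_irrefl n), Finset.filter_true_of_mem fun j _ => j.2]

end

end SpinCanonical

theorem mainTheorem1 (n : ℕ) (hn : 1 ≤ n) (S : Finset ℕ) (hS : S ⊆ Finset.Icc 1 n) :
    -- the canonical elements
    (Even (∑ i ∈ S, i) →
      ∀ ξ : SpinCanonical.torus n,
        SpinCanonical.IsCanonical n S ξ ↔ ξ = SpinCanonical.xi n S) ∧
    (Odd (∑ i ∈ S, i) →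
      ∀ ξ : SpinCanonical.torus n,
        SpinCanonical.IsCanonical n S ξ ↔
          ∃ j ∈ S, Odd j ∧ ξ = SpinCanonical.H n j + SpinCanonical.xi n S) ∧
    -- the uniton numbers for the irreducible representation with highest weight `ω_k`
    (∀ k ∈ Finset.Icc 1 n,
      ∀ (V : Type*) [AddCommGroup V] [Module ℂ V] [LieRingModule (SpinCanonical.LieGC n) V]
        [LieModule ℂ (SpinCanonical.LieGC n) V] [FiniteDimensional ℂ V]
        [LieModule.IsIrreducible ℂ (SpinCanonical.LieGC n) V],
        SpinCanonical.IsHighestWeight n V (SpinCanonical.fundWeight n k) →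
        (k < n →
          SpinCanonical.unitonNumber n V (SpinCanonical.xi n S) =
              ∑ m ∈ Finset.Icc 1 k, 2 * ((S ∩ Finset.Icc m n).card : ℂ) ∧
          (Odd (∑ i ∈ S, i) → ∀ j ∈ S, Odd j →
            SpinCanonical.unitonNumber n V (SpinCanonical.H n j + SpinCanonical.xi n S) =
              SpinCanonical.unitonNumber n V (SpinCanonical.xi n S) + 2 * ((min j k : ℕ) : ℂ))) ∧
        (k = n →
          SpinCanonical.unitonNumber n V (SpinCanonical.xi n S) =
              (∑ m ∈ Finset.Icc 1 n, 2 * ((S ∩ Finset.Icc m n).card : ℂ)) / 2 ∧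
          (Odd (∑ i ∈ S, i) → ∀ j ∈ S, Odd j →
            SpinCanonical.unitonNumber n V (SpinCanonical.H n j + SpinCanonical.xi n S) =
              ((∑ m ∈ Finset.Icc 1 n, 2 * ((S ∩ Finset.Icc m n).card : ℂ)) +
                2 * ((min j n : ℕ) : ℂ)) / 2))) := by
  refine ⟨SpinCanonical.isCanonical_iff_of_even hS, SpinCanonical.isCanonical_iff_of_odd hS, ?_⟩
  intro k hk V _ _ _ _ _ _ hω
  have hI := Complex.I_ne_zero
  rw [Finset.mem_Icc] at hk
  refine ⟨fun hkn => ⟨?_, fun _ j _ _ => ?_⟩, ?_⟩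
  · rw [SpinCanonical.unitonNumber_eq V hω, SpinCanonical.fundWeight, if_pos hkn,
      SpinCanonical.sum_L_xi hS hk.2, ← Finset.mul_sum]
    field_simp
  · rw [SpinCanonical.unitonNumber_eq V hω, SpinCanonical.unitonNumber_eq V hω, map_add,
      SpinCanonical.fundWeight, if_pos hkn, SpinCanonical.sum_L_H j hk.2]
    field_simp
    ring
  · rintro rfl
    refine ⟨?_, fun _ j _ _ => ?_⟩
    · rw [SpinCanonical.unitonNumber_eq V hω, SpinCanonical.fundWeight_top, LinearMap.smul_apply,
        SpinCanonical.sum_L_xi hS le_rfl, ← Finset.mul_sum, Complex.real_smul]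
      push_cast
      field_simp
    · rw [SpinCanonical.unitonNumber_eq V hω, map_add, SpinCanonical.fundWeight_top,
        LinearMap.smul_apply, LinearMap.smul_apply, SpinCanonical.sum_L_xi hS le_rfl,
        SpinCanonical.sum_L_H j le_rfl, ← Finset.mul_sum, Complex.real_smul, Complex.real_smul]
      push_cast
      field_simp
      ring
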